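/- **Setting.** A *Dual-Behavior Mealy Machine* (DBMM) $\mathcal N=\langle V,v_0,\mathcal I_\alpha,\mathcal I_\beta,\mathcal O,\mathcal T,\mathcal G\rangle$ has a finite state set $V$, an initial state $v_0$, disjoint input alphabets $\mathcal I_\alpha$ and $\mathcal I_\beta$ ($\mathcal I_\beta$ finite), a transition function $\mathcal T:V\times\mathcal I_\beta\to V$, and an output function $\mathcal G:V\times\mathcal I_\alpha\to\mathcal O$, which may be undefined at some pairs. Let $\mathcal T^*(q,w)$ be the state reached from $q$ by processing the $\beta$-inputs of $w$. For a set $R$ of triples $(w,a,o)\in\mathcal I_\beta^*\times\mathcal I_\alpha\times\mathcal O$ (after $w$, the input $a$ is answered by $o$), $\mathcal N$ is *resolvent for $R$* if $\mathcal G(\mathcal T^*(v_0,w),a)=o$ for all $(w,a,o)\in R$, and *minimal resolvent for $R$* if moreover no DBMM that is resolvent for $R$ has fewer states. A *sample* is an input sequence over $\mathcal I_\alpha\cup\mathcal I_\beta$ with an output sequence of the same length (outputs at $\beta$-inputs are placeholders). For a finite family $\mathcal S$ of samples, let $R_{\mathcal S}$ be the set of triples $(w,a,o)$ such that some sample has the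 $\alpha$-input $a$ with output $o$ at a position before which its $\beta$-inputs form the word $w$. Sample prefixes $u,v$ *conflict* if for some $a\in\mathcal I_\alpha$ and $o_1\ne o_2$ both $(u_\beta,a,o_1)$ and $(v_\beta,a,o_2)$ lie in $R_{\mathcal S}$, where $u_\beta,v_\beta$ are the $\beta$-words of $u,v$. $\mathcal S$ is *structure complete* for $\mathcal N$ if (state coverage) every state is $\mathcal T^*(v_0,u)$ for some (possibly empty) sample prefix $u$; (transition coverage) for every $q\in V$ and $l\in\mathcal I_\beta$ some sample has a prefix $u$ with $\mathcal T^*(v_0,u)=q$ that is directly followed by $l$; and (conflict convergence) any two sample prefixes that lead from $v_0$ to different states conflict. **Algorithm.** The *prefix tree transducer* (PTT) of $\mathcal S$ has one state for each $\beta$-word of a sample prefix, the tree transitions, and at each state the outputs recorded there (a later record overwrites an earlier one). DB-RPNI merges states of the PTT. Initially the root is the only red state; the blue states are the non-red successors of red states. While a blue state $b$ exists, one is selected (arbitrarily), and the red states $r$ are tried (in any order): the transition into $b$ is redirected to $r$ and $b$ is folded into $r$, that is, outputs are united, transitions of $b$ that are missing at $r$ are moved to $r$, and successors of $b$ and $r$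 under a common input are folded recursively. The attempt fails, and is undone, at the first pair of states having different outputs for a same $\alpha$-input. The first merge that does not fail is kept; if all fail, $b$ becomes red. When no blue state is left, the current machine is returned. Time is that of this merging phase, starting from the PTT; it counts one unit for each pair of states folded, and for each table entry (a recorded output or a transition of a state) that is looked up, compared, written or scanned. Undoing an attempt costs as much as the attempt. **Theorem.** Let $T$ be the number of states of the PTT, $F$ the maximum number of $\alpha$-inputs with defined output at a state of the PTT, and $|L|=|\mathcal I_\beta|$; in the bounds, $F$ and $|L|$ are replaced by $1$ if they are $0$. The following holds for every finite family $\mathcal S$ of samples and all executions of DB-RPNI, with an absolute constant in both $O(\cdot)$. 1. Let $R$ (the feasible behaviors of the environment) contain $R_{\mathcal S}$, let $\mathcal N$ (the target) be a DBMM with state set $U$ that is resolvent for $R$, and let $\mathcal S$ be structure complete for $\mathcal N$. Then DB-RPNI returns a DBMM $\mathcal D$ with the following properties. - There is a bijection $\varphi$ from $U$ to the states of $\mathcal D$ that respects initial states and transitions, and $\mathcal D$ has output $o$ at $(\varphi(q),a)$ if and only if $(w,a,o)\in R_{\mathcal S}$ for some $w$ with $\mathcal T^*(v_0,w)=q$.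 So $\mathcal D$ is the target with the outputs recorded in the samples. - $\mathcal D$ is minimal resolvent for $R_{\mathcal S}$. It is the only one in the following sense: for every DBMM $\mathcal E$ with $|U|$ states that is resolvent for $R_{\mathcal S}$, there is a bijection from the states of $\mathcal D$ to those of $\mathcal E$ that respects initial states, transitions and all outputs defined in $\mathcal D$. - $\mathcal D$ is minimal resolvent for the environment $R$ if and only if for every $(w,a,o)\in R$ there is $(u,a,o)\in R_{\mathcal S}$ with $\mathcal T^*(v_0,u)=\mathcal T^*(v_0,w)$, that is, every feasible output of a target state is recorded at some prefix leading to that state. 2. In the situation of 1, DB-RPNI runs in time $O(|U|\cdot|L|\cdot T\cdot F)$. 3. For arbitrary $\mathcal S$, DB-RPNI always stops, and it runs in time $O(T^3\cdot F)$. -/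

import Mathlib

/-! ## Dual-behavior Mealy machines, samples, structure completeness -/

/-- A dual-behavior Mealy machine: inputs from `A` (alpha) read an output and leave the state
unchanged, inputs from `B` (beta) change the state.  The output function may be undefined at some
pairs; the machines with a total output function are the special case in which `out` is never
`none`. -/
structure DBMM (V A B O : Type*) where
  init : V
  trans : V → B → V
  out : V → A → Option O

/-- The state reached from the initial state by a word of beta-inputs. -/
def DBMM.run {V A B O : Type*} (N : DBMM V A B O) (w : List B) : V :=
  w.foldl N.trans N.init

/-- A machine is resolvent for a set `R` of feasible behaviors `(w, a, o)` (after the beta-word `w`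
the alpha-input `a` is answered by `o`) if it predicts all of them. -/
def DBMM.Resolvent {V A B O : Type*} (N : DBMM V A B O) (R : Set (List B × A × O)) : Prop :=
  ∀ w a o, (w, a, o) ∈ R → N.out (N.run w) a = some o

/-- Resolvent, and no resolvent machine has fewer states. -/
def DBMM.MinimalResolvent {V A B O : Type*} [Fintype V] (N : DBMM V A B O)
    (R : Set (List B × A × O)) : Prop :=
  N.Resolvent R ∧
    ∀ (n : ℕ) (E : DBMM (Fin n) A B O), E.Resolvent R → Fintype.card V ≤ n

/-- A sample, i.e. an input sequence together with an output sequence of the same length, written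
as a sequence of input-output steps.  The output at a beta-input is a mere placeholder. -/
abbrev Sample (A B O : Type*) : Type _ := List ((A ⊕ B) × O)

/-- The word of beta-inputs that occur in a sample. -/
def Sample.betaWord {A B O : Type*} (s : Sample A B O) : List B :=
  s.filterMap fun e => e.1.getRight?

/-- The behaviors `(w, a, o)` recorded in a collection of samples. -/
def observed {A B O : Type*} (S : List (Sample A B O)) : Set (List B × A × O) :=
  {x | ∃ s ∈ S, ∃ i : ℕ, s[i]? = some (Sum.inl x.2.1, x.2.2) ∧
    Sample.betaWord (s.take i) = x.1}

/-- The samples record two different outputs for the same alpha-input, one after the input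
sequence `u` and one after the input sequence `v`. -/
def Conflict {A B O : Type*} (S : List (Sample A B O)) (u v : Sample A B O) : Prop :=
  ∃ a o₁ o₂, (u.betaWord, a, o₁) ∈ observed S ∧ (v.betaWord, a, o₂) ∈ observed S ∧ o₁ ≠ o₂

/-- Structure completeness of the samples for the underlying machine `N`. -/
structure StructureComplete {V A B O : Type*} (N : DBMM V A B O) (S : List (Sample A B O)) :
    Prop where
  stateCoverage : ∀ q : V, ∃ s ∈ S, ∃ i : ℕ, N.run (Sample.betaWord (s.take i)) = q
  transitionCoverage : ∀ (q₁ q₂ : V) (l : B), N.trans q₁ l = q₂ →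
    ∃ s ∈ S, ∃ (i : ℕ) (o : O), s[i]? = some (Sum.inr l, o) ∧
      N.run (Sample.betaWord (s.take i)) = q₁
  conflictConvergence : ∀ s₁ ∈ S, ∀ s₂ ∈ S, ∀ i j : ℕ,
    N.run (Sample.betaWord (s₁.take i)) ≠ N.run (Sample.betaWord (s₂.take j)) →
      Conflict S (s₁.take i) (s₂.take j)

/-! ## The data structure of the algorithm and the prefix tree transducer -/

/-- A partial machine with state names in `σ`: every state carries a finite table of its outgoing
transitions and a finite table of its recorded outputs. -/
structure Transducer (σ A B O : Type*) where
  states : Finset σ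
  init : σ
  tr : σ → AList fun _ : B => σ
  out : σ → AList fun _ : A => O

namespace Transducer

variable {σ A B O : Type*} [DecidableEq σ] [DecidableEq A] [DecidableEq B] [DecidableEq O]

/-- Number of transitions stored at a state. -/
def trSize (M : Transducer σ A B O) (q : σ) : ℕ := (M.tr q).entries.length

/-- Number of alpha-inputs with defined output at a state. -/
def outSize (M : Transducer σ A B O) (q : σ) : ℕ := (M.out q).entries.length

/-- The largest number of alpha-inputs with defined output at a state. -/
def maxOut (M : Transducer σ A B O) : ℕ := M.states.sup M.outSize

/-- The transducer `M` is the machine `D` (with total transition function) on its states. -/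
structure Is (M : Transducer σ A B O) (D : DBMM {q // q ∈ M.states} A B O) : Prop where
  init_eq : M.init = D.init.1
  tr_eq : ∀ (q : {q // q ∈ M.states}) (l : B), (M.tr q.1).lookup l = some (D.trans q l).1
  out_eq : ∀ (q : {q // q ∈ M.states}) (a : A), (M.out q.1).lookup a = D.out q a

/-- Local compatibility: the alpha-inputs with an output at both states have the same output. -/
def Compatible (M : Transducer σ A B O) (u v : σ) : Prop :=
  ∀ e ∈ (M.out v).entries, ∀ o ∈ (M.out u).lookup e.1, o = e.2

instance (M : Transducer σ A B O) (u v : σ) : Decidable (M.Compatible u v) :=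
  inferInstanceAs (Decidable (∀ e ∈ (M.out v).entries, ∀ o ∈ (M.out u).lookup e.1, o = e.2))

/-- State `b` is absorbed by state `r`: the outputs of `b` are added to those of `r`, the
transitions of `b` with a label that has no transition at `r` are moved to `r`. -/
def absorb (M : Transducer σ A B O) (r b : σ) : Transducer σ A B O where
  states := M.states.erase b
  init := M.init
  tr := Function.update M.tr r (M.tr r ∪ M.tr b)
  out := Function.update M.out r (M.out r ∪ M.out b)

/-- The merges implied by merging `b` into `r`: successors under a common label. -/
def implied (M : Transducer σ A B O) (r b : σ) : List (σ × σ) :=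
  (M.tr b).entries.filterMap fun e => ((M.tr r).lookup e.1).map fun d => (d, e.2)

/-- The folding operation, with its running time: the pending merges `(r, b)` are carried out one
after the other, together with all merges that they imply; the operation is abandoned at the first
pair that is not locally compatible.  A pair whose merge was already done is skipped.
The time counts one unit per pair treated, per output entry of `b` compared, per output entry of
`b` written to `r`, and per transition of `b` inspected. -/
def fold (M : Transducer σ A B O) : List (σ × σ) → Option (Transducer σ A B O) × ℕ
  | [] => (some M, 1)
  | (r, b) :: ws =>
    if b ∈ M.states ∧ r ≠ b then
      if M.Compatible r b then
        let res := fold (M.absorb r b) (M.implied r b ++ ws)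
        (res.1, (1 + M.outSize b) + (M.outSize b + M.trSize b) + res.2)
      else (none, 1 + M.outSize b)
    else
      let res := fold M ws
      (res.1, 1 + res.2)
  termination_by ws => (M.states.card, ws.length)
  decreasing_by
    · rename_i h _
      exact Prod.Lex.left _ _ (Finset.card_erase_lt_of_mem h.1)
    · exact Prod.Lex.right _ (Nat.lt_succ_self _)

/-- Redirect the transition of `p` under `l` to `r`. -/
def redirect (M : Transducer σ A B O) (p : σ) (l : B) (r : σ) : Transducer σ A B O :=
  { M with tr := Function.update M.tr p ((M.tr p).insert l r) }

/-- Merging the blue state `b`, which is entered by the transition of `p` under `l`, into the red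
state `r`: the result (`none` if the two states are not mergeable) and the time of the folding. -/
def merge (M : Transducer σ A B O) (p : σ) (l : B) (b r : σ) :
    Option (Transducer σ A B O) × ℕ :=
  (M.redirect p l r).fold [(r, b)]

/-- The loop over the red states: the first mergeable red state is merged with `b`.  If the
folding takes time `t`, then the mergeability test takes `2 * t` (folding and undoing it), and a
merge that is carried out takes another `t`. -/
def tryRed (M : Transducer σ A B O) (p : σ) (l : B) (b : σ) :
    List σ → Option (Transducer σ A B O) × ℕ
  | [] => (none, 1)
  | r :: rs =>
    match M.merge p l b r with
    | (some M', t) => (some M', 1 + 2 * t + t)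
    | (none, t) =>
      let res := tryRed M p l b rs
      (res.1, 1 + 2 * t + res.2)

/-- One step of building the prefix tree transducer.  A new state is named by the beta-word that
leads to it. -/
def pttStep (c : Transducer (List B) A B O × List B) :
    (A ⊕ B) × O → Transducer (List B) A B O × List B
  | (Sum.inl a, o) =>
    ({ c.1 with out := Function.update c.1.out c.2 ((c.1.out c.2).insert a o) }, c.2)
  | (Sum.inr l, _) =>
    match (c.1.tr c.2).lookup l with
    | some q => (c.1, q)
    | none =>
      ({ c.1 with
          states := insert (c.2 ++ [l]) c.1.states
          tr := Function.update c.1.tr c.2 ((c.1.tr c.2).insert l (c.2 ++ [l])) }, c.2 ++ [l])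

/-- The prefix tree transducer of a collection of samples, processed in the given order. -/
def ptt (S : List (Sample A B O)) : Transducer (List B) A B O :=
  S.foldl (fun M s => (s.foldl pttStep (M, M.init)).1)
    { states := {[]}, init := [], tr := fun _ => ∅, out := fun _ => ∅ }

end Transducer

/-! ## The red-blue state-merging algorithm -/

namespace DBRPNI

variable {σ A B O : Type*} [DecidableEq σ] [DecidableEq A] [DecidableEq B] [DecidableEq O]

/-- The current machine and the list of red states. -/
structure Config (σ A B O : Type*) where
  mach : Transducer σ A B O
  red : List σ

/-- `b` is a blue state: it is not red and is entered from the red state `p` under `l`. -/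
def Config.Blue (c : Config σ A B O) (p : σ) (l : B) (b : σ) : Prop :=
  p ∈ c.red ∧ (c.mach.tr p).lookup l = some b ∧ b ∉ c.red

/-- Time for computing the set of blue states: a scan of the transitions of the red states. -/
def Config.blueTime (c : Config σ A B O) : ℕ :=
  1 + (c.red.map fun r => 1 + c.mach.trSize r).sum

/-- One round of the main loop, with its running time.  Any blue state may be selected, and the
red states may be tried in any order `rs`. -/
inductive Step : Config σ A B O → ℕ → Config σ A B O → Prop
  | merge {c : Config σ A B O} {p : σ} {l : B} {b : σ} {rs : List σ}
      {M : Transducer σ A B O} {t : ℕ} :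
      c.Blue p l b → rs.Perm c.red → c.mach.tryRed p l b rs = (some M, t) →
      Step c (c.blueTime + t) ⟨M, c.red⟩
  | promote {c : Config σ A B O} {p : σ} {l : B} {b : σ} {rs : List σ} {t : ℕ} :
      c.Blue p l b → rs.Perm c.red → c.mach.tryRed p l b rs = (none, t) →
      Step c (c.blueTime + t) ⟨c.mach, b :: c.red⟩

/-- Finitely many rounds of the main loop, with their total running time. -/
inductive Run : Config σ A B O → ℕ → Config σ A B O → Prop
  | refl (c : Config σ A B O) : Run c 0 c
  | tail {c d e : Config σ A B O} {s t : ℕ} : Run c s d → Step d t e → Run c (s + t) e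

/-- The configuration in which the merging starts on the prefix tree transducer. -/
def start (S : List (Sample A B O)) : Config (List B) A B O :=
  ⟨Transducer.ptt S, [(Transducer.ptt S).init]⟩

/-- From the configuration `c` the main loop can stop after time `t` and return `M`. -/
def ReturnsFrom (c : Config σ A B O) (M : Transducer σ A B O) (t : ℕ) : Prop :=
  ∃ (d : Config σ A B O) (s : ℕ), Run c s d ∧ (∀ p l b, ¬ d.Blue p l b) ∧
    M = d.mach ∧ t = s + d.blueTime

/-- On the samples `S` the algorithm can return `M` after time `t` spent on state merging. -/
def Returns (S : List (Sample A B O)) (M : Transducer (List B) A B O) (t : ℕ) : Prop :=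
  ReturnsFrom (start S) M t

end DBRPNI

/-!
# State merging learns dual-behavior Mealy machines

During a folding the states that are not red form a forest below the red ones, and the second
components of the pending merges are roots of detached trees (`PartialFold`; preserved by
`PartialFold.absorb`, established by `PartialFold.redirect`).  Hence no pair of states is ever
skipped, and a state is absorbed with the tables it had when the folding started.  Since absorbing
creates no table entries in total (`Reduces`), a folding takes time linear in the number of states,
transitions and outputs of the prefix tree, that is `O(T * F)` (`PartialFold.fold_time_le`).  Every
round of the main loop reduces the number of states that are not red and tries at most `T` red
states.  This gives termination and the bound `O(T ^ 3 * F)`.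

States are named by words, so for structure complete samples of a target `N` the map `N.run` labels
every state of the current machine by a target state, and this labelling stays a homomorphism that
covers all states, transitions and recorded outputs of the target (`Labelled`).  States with equal
labels are compatible because `N` predicts all outputs; states with different labels conflict
already in the outputs recorded at their names.  So a blue state is merged with the red state of
the same label, if there is one, and all other attempts fail at the first pair
(`DBRPNI.Config.Correct.tryRed`).  In the end all states are red, the labelling is a bijection, and
the result is the target with the recorded outputs (`Labelled.exists_is`).  Minimality and
uniqueness follow from conflict convergence: a machine that reproduces the samples must separate all
target states (`StructureComplete.run_eq_of_run_eq`).

For the running time under structure complete samples, every round makes one more pair of a red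
state and a beta-input lead to a red state, so there are at most `|U| * |L|` rounds, each with at
most one complete folding.  The failing attempts of a round cost at most `|U|` times the outputs
of the selected blue state; these outputs leave the part that is not red in the same round, so the
failing attempts cost `O(|U| * T * F)` in total, apart from a constant time for each
(`DBRPNI.Config.Correct.step_time_le`).
-/

set_option linter.unusedSectionVars false

/-! ### Tables -/

theorem AList.length_entries_union_le {α : Type*} {β : α → Type*} [DecidableEq α]
    (s t : AList β) :
    (s ∪ t).entries.length ≤ s.entries.length + t.entries.length := by
  have key : ∀ l₁ l₂ : List (Sigma β), (l₁.kunion l₂).length ≤ l₁.length + l₂.length := by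
    intro l₁
    induction l₁ with
    | nil => intro l₂; simp
    | cons e l₁ ih =>
      intro l₂
      have h₁ := ih (List.kerase e.1 l₂)
      have h₂ : (List.kerase e.1 l₂).length ≤ l₂.length := List.length_eraseP_le
      simp only [List.kunion_cons, List.length_cons]
      omega
  rw [AList.union_entries]
  exact key _ _

/-- Overwriting an entry does not change the size of a table. -/
theorem AList.length_entries_insert_of_mem {α : Type*} {β : α → Type*} [DecidableEq α]
    {a : α} (b : β a) {s : AList β} (h : a ∈ s) :
    (s.insert a b).entries.length = s.entries.length := by
  have hlen : ∀ t : AList β, t.entries.length = t.keys.length := fun t => by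
    simp [AList.keys, List.keys]
  rw [hlen, hlen, AList.keys_insert, List.length_cons, List.length_erase_of_mem h]
  have := List.length_pos_of_mem (AList.mem_keys.1 h)
  omega

namespace Transducer

variable {σ A B O : Type*} [DecidableEq σ] [DecidableEq A] [DecidableEq B] [DecidableEq O]

/-! ### Paths in a transducer -/

/-- The transducer has a transition from the state `p` under `l` to `q`. -/
def Edge (M : Transducer σ A B O) (p : σ) (l : B) (q : σ) : Prop :=
  p ∈ M.states ∧ (M.tr p).lookup l = some q

/-- There is a path of transitions from the first state to the second. -/
def Reach (M : Transducer σ A B O) : σ → σ → Prop :=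
  Relation.ReflTransGen fun p q => ∃ l, M.Edge p l q

section absorb

variable {M : Transducer σ A B O} {r b : σ}

theorem tr_absorb_of_ne {q : σ} (h : q ≠ r) : (M.absorb r b).tr q = M.tr q :=
  Function.update_of_ne h _ _

theorem out_absorb_of_ne {q : σ} (h : q ≠ r) : (M.absorb r b).out q = M.out q :=
  Function.update_of_ne h _ _

theorem lookup_tr_absorb_self {l : B} {x : σ} :
    ((M.absorb r b).tr r).lookup l = some x ↔
      (M.tr r).lookup l = some x ∨ (M.tr r).lookup l = none ∧ (M.tr b).lookup l = some x := by
  simp only [absorb, Function.update_self, AList.lookup_union_eq_some, AList.lookup_eq_none]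

theorem lookup_out_absorb_self {a : A} {o : O} :
    ((M.absorb r b).out r).lookup a = some o ↔
      (M.out r).lookup a = some o ∨ (M.out r).lookup a = none ∧ (M.out b).lookup a = some o := by
  simp only [absorb, Function.update_self, AList.lookup_union_eq_some, AList.lookup_eq_none]

theorem lookup_tr_absorb {q x : σ} {l : B} (h : (M.tr q).lookup l = some x) :
    ((M.absorb r b).tr q).lookup l = some x := by
  by_cases hq : q = r
  · subst hq
    exact lookup_tr_absorb_self.2 (Or.inl h)
  · rwa [tr_absorb_of_ne hq]

theorem lookup_out_absorb {q : σ} {a : A} {o : O} (h : (M.out q).lookup a = some o) :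
    ((M.absorb r b).out q).lookup a = some o := by
  by_cases hq : q = r
  · subst hq
    exact lookup_out_absorb_self.2 (Or.inl h)
  · rwa [out_absorb_of_ne hq]

theorem mem_implied {d e : σ} :
    (d, e) ∈ M.implied r b ↔
      ∃ l, (M.tr r).lookup l = some d ∧ (M.tr b).lookup l = some e := by
  simp only [implied, List.mem_filterMap, Option.map_eq_some_iff, Prod.mk.injEq]
  constructor
  · rintro ⟨⟨l, x⟩, hx, y, hy, rfl, rfl⟩
    exact ⟨l, hy, AList.mem_lookup_iff.2 hx⟩
  · rintro ⟨l, hd, he⟩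
    exact ⟨⟨l, e⟩, AList.mem_lookup_iff.1 he, d, hd, rfl, rfl⟩

theorem length_implied_le : (M.implied r b).length ≤ M.trSize b :=
  List.length_filterMap_le _ _

theorem edge_absorb {p x : σ} {l : B} (hr : r ∈ M.states) (hrb : r ≠ b) :
    (M.absorb r b).Edge p l x ↔ p ≠ b ∧ (M.Edge p l x ∨
      p = r ∧ (M.tr r).lookup l = none ∧ (M.tr b).lookup l = some x) := by
  unfold Edge
  by_cases hp : p = r
  · subst hp
    rw [lookup_tr_absorb_self]
    simp [absorb, hrb, hr]
  · rw [tr_absorb_of_ne hp]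
    simp [absorb, hp, and_assoc]

/-- Paths that start outside an unentered state survive when this state is absorbed. -/
theorem Reach.absorb {x y : σ} (hb : ∀ p l, ¬ M.Edge p l b) (hx : x ≠ b) (h : M.Reach x y) :
    (M.absorb r b).Reach x y ∧ y ≠ b := by
  induction h with
  | refl => exact ⟨.refl, hx⟩
  | tail _ e ih =>
    obtain ⟨l, e⟩ := e
    refine ⟨ih.1.tail ⟨l, ?_, lookup_tr_absorb e.2⟩, ?_⟩
    · exact Finset.mem_erase.2 ⟨ih.2, e.1⟩
    · rintro rfl
      exact hb _ _ e

end absorb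

theorem edge_redirect {M : Transducer σ A B O} {p r : σ} {l : B} {x y : σ} {m : B} :
    (M.redirect p l r).Edge x m y ↔
      x = p ∧ m = l ∧ y = r ∧ p ∈ M.states ∨ (x = p → m ≠ l) ∧ M.Edge x m y := by
  unfold Edge redirect
  by_cases hx : x = p
  · subst hx
    by_cases hm : m = l
    · subst hm
      simp [AList.lookup_insert, and_comm, eq_comm]
    · simp [AList.lookup_insert_ne hm, hm]
  · simp [hx]

/-! ### The forest of states that are not red -/

/-- The situation during a folding: every state that is not red is entered by at most one
transition and has no red successors, so these states form a forest below the red ones.  The second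
components of the pending merges `ws` are roots of detached trees, the first components belong to
the part that is reachable from the initial state, and there are no other states. -/
structure PartialFold (M : Transducer σ A B O) (red : List σ) (ws : List (σ × σ)) : Prop where
  init_mem : M.init ∈ red
  red_sub : ∀ r ∈ red, r ∈ M.states
  closed : ∀ p l q, M.Edge p l q → q ∈ M.states
  unique : ∀ p l p' l' q, q ∉ red → M.Edge p l q → M.Edge p' l' q → p = p' ∧ l = l'
  succ : ∀ p l q, p ∉ red → M.Edge p l q → q ∉ red
  nodup : (ws.map Prod.snd).Nodup
  pending : ∀ w ∈ ws, w.2 ∈ M.states ∧ w.2 ∉ red ∧ ∀ p l, ¬ M.Edge p l w.2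
  target : ∀ w ∈ ws, M.Reach M.init w.1
  cover : ∀ x ∈ M.states, M.Reach M.init x ∨ ∃ w ∈ ws, M.Reach w.2 x

namespace PartialFold

variable {M : Transducer σ A B O} {red : List σ} {ws : List (σ × σ)} {r b : σ}

theorem mem_of_reach (h : PartialFold M red ws) {x : σ} (hx : M.Reach M.init x) :
    x ∈ M.states := by
  cases hx with
  | refl => exact h.red_sub _ h.init_mem
  | tail _ e => exact h.closed _ _ _ e.choose_spec

theorem init_ne (h : PartialFold M red ((r, b) :: ws)) : M.init ≠ b := by
  rintro rfl
  exact (h.pending _ List.mem_cons_self).2.1 h.init_mem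

theorem ne (h : PartialFold M red ((r, b) :: ws)) : r ≠ b := by
  have hb := h.pending _ List.mem_cons_self
  have hr := h.target _ List.mem_cons_self
  rintro rfl
  cases hr with
  | refl => exact h.init_ne rfl
  | tail _ e => exact hb.2.2 _ _ e.choose_spec

theorem absorb (h : PartialFold M red ((r, b) :: ws)) :
    PartialFold (M.absorb r b) red (M.implied r b ++ ws) := by
  obtain ⟨hbs, hbr, hbe⟩ := h.pending _ List.mem_cons_self
  have hr : M.Reach M.init r := h.target _ List.mem_cons_self
  have hrs := h.mem_of_reach hr
  have hrb := h.ne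
  dsimp only at hbs hbr hbe
  have hedge : ∀ {p l x}, (M.absorb r b).Edge p l x → p ≠ b ∧ (M.Edge p l x ∨
      p = r ∧ (M.tr r).lookup l = none ∧ (M.tr b).lookup l = some x) :=
    fun e => (edge_absorb hrs hrb).1 e
  have hreach : ∀ {x}, M.Reach M.init x → (M.absorb r b).Reach M.init x := fun hx =>
    (hx.absorb hbe h.init_ne).1
  -- a successor of the absorbed state had its only entrance there
  have hsucc : ∀ {l x p m}, (M.tr b).lookup l = some x → M.Edge p m x → p = b ∧ m = l :=
    fun {l x p m} hx e => h.unique _ _ _ _ _ (h.succ _ _ _ hbr ⟨hbs, hx⟩) e ⟨hbs, hx⟩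
  constructor
  · exact h.init_mem
  · intro x hx
    refine Finset.mem_erase.2 ⟨?_, h.red_sub x hx⟩
    rintro rfl
    exact hbr hx
  · intro p l q e
    obtain ⟨-, e | ⟨-, -, e⟩⟩ := hedge e
    · exact Finset.mem_erase.2 ⟨fun hq => hbe p l (hq ▸ e), h.closed _ _ _ e⟩
    · exact Finset.mem_erase.2 ⟨fun hq => hbe b l ⟨hbs, hq ▸ e⟩, h.closed _ _ _ ⟨hbs, e⟩⟩
  · intro p l p' l' q hq e e'
    obtain ⟨hp, f | ⟨hpr, -, f⟩⟩ := hedge e <;> obtain ⟨hp', f' | ⟨hpr', -, f'⟩⟩ := hedge e'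
    · exact h.unique _ _ _ _ _ hq f f'
    · exact absurd (hsucc f' f).1 hp
    · exact absurd (hsucc f f').1 hp'
    · exact ⟨hpr.trans hpr'.symm, (hsucc f' ⟨hbs, f⟩).2⟩
  · intro p l q hp e
    obtain ⟨-, e | ⟨-, -, e⟩⟩ := hedge e
    · exact h.succ _ _ _ hp e
    · exact h.succ _ _ _ hbr ⟨hbs, e⟩
  · have hnd : (ws.map Prod.snd).Nodup := (List.nodup_cons.1 h.nodup).2
    rw [List.map_append, List.nodup_append']
    refine ⟨?_, hnd, ?_⟩
    · have hsub : List.Sublist ((M.implied r b).map Prod.snd)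
          ((M.tr b).entries.map fun e => e.2) := by
        unfold implied
        induction (M.tr b).entries with
        | nil => simp
        | cons e l ih =>
          rw [List.filterMap_cons]
          cases (M.tr r).lookup e.1 with
          | none => exact ih.cons _
          | some d => exact ih.cons_cons _
      refine hsub.nodup (List.Nodup.map_on ?_ (List.Nodup.of_map Sigma.fst (M.tr b).nodupKeys))
      rintro ⟨l, x⟩ hx ⟨m, y⟩ hy (rfl : x = y)
      rw [(hsucc (AList.mem_lookup_iff.2 hx) ⟨hbs, AList.mem_lookup_iff.2 hy⟩).2]
    · intro x hx hx'
      obtain ⟨⟨d, _⟩, hw, rfl⟩ := List.mem_map.1 hx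
      obtain ⟨w, hw', hwx⟩ := List.mem_map.1 hx'
      obtain ⟨l, -, he⟩ := mem_implied.1 hw
      exact (h.pending _ (List.mem_cons_of_mem _ hw')).2.2 b l ⟨hbs, hwx ▸ he⟩
  · intro w hw
    rcases List.mem_append.1 hw with hw | hw
    · obtain ⟨d, x⟩ := w
      obtain ⟨l, hd, he⟩ := mem_implied.1 hw
      refine ⟨Finset.mem_erase.2 ⟨fun hq => hbe b l ⟨hbs, hq ▸ he⟩, h.closed _ _ _ ⟨hbs, he⟩⟩,
        h.succ _ _ _ hbr ⟨hbs, he⟩, fun p m e => ?_⟩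
      obtain ⟨hp, e | ⟨rfl, hn, e⟩⟩ := hedge e
      · exact hp (hsucc he e).1
      · obtain ⟨-, rfl⟩ := hsucc he ⟨hbs, e⟩
        rw [hn] at hd
        cases hd
    · obtain ⟨hws, hwr, hwe⟩ := h.pending _ (List.mem_cons_of_mem _ hw)
      refine ⟨Finset.mem_erase.2 ⟨?_, hws⟩, hwr, fun p m e => ?_⟩
      · intro hwb
        exact (List.nodup_cons.1 h.nodup).1 (List.mem_map.2 ⟨w, hw, hwb⟩)
      · obtain ⟨hp, e | ⟨rfl, hn, e⟩⟩ := hedge e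
        · exact hwe _ _ e
        · exact hwe _ _ ⟨hbs, e⟩
  · intro w hw
    rcases List.mem_append.1 hw with hw | hw
    · obtain ⟨d, x⟩ := w
      obtain ⟨l, hd, he⟩ := mem_implied.1 hw
      exact hreach (hr.tail ⟨l, hrs, hd⟩)
    · exact hreach (h.target _ (List.mem_cons_of_mem _ hw))
  · intro x hx
    obtain ⟨hxb, hx⟩ := Finset.mem_erase.1 hx
    rcases h.cover x hx with hx | ⟨w, hw, hx⟩
    · exact Or.inl (hreach hx)
    rcases List.mem_cons.1 hw with rfl | hw
    · -- a path from the absorbed state goes on from one of its successors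
      rcases Relation.ReflTransGen.cases_head hx with hx | ⟨y, ⟨l, hbs', hy⟩, hx⟩
      · exact absurd hx.symm hxb
      have hyb : y ≠ b := fun hq => hbe b l ⟨hbs, hq ▸ hy⟩
      have hx' := (Reach.absorb (r := r) hbe hyb hx).1
      cases hd : (M.tr r).lookup l with
      | none =>
        refine Or.inl (Relation.ReflTransGen.trans ((hreach hr).tail ⟨l, ?_⟩) hx')
        exact (edge_absorb hrs hrb).2 ⟨hrb, Or.inr ⟨rfl, hd, hy⟩⟩
      | some d =>
        exact Or.inr ⟨(d, y), List.mem_append_left _ (mem_implied.2 ⟨l, hd, hy⟩), hx'⟩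
    · refine Or.inr ⟨w, List.mem_append_right _ hw, (hx.absorb hbe ?_).1⟩
      intro hwb
      exact (List.nodup_cons.1 h.nodup).1 (List.mem_map.2 ⟨w, hw, hwb⟩)

/-- Redirecting the transition into a blue state detaches the tree below it. -/
theorem redirect (h : PartialFold M red []) {p r b : σ} {l : B} (hp : p ∈ red)
    (hb : (M.tr p).lookup l = some b) (hbr : b ∉ red) (hr : r ∈ red) :
    PartialFold (M.redirect p l r) red [(r, b)] := by
  have hps := h.red_sub p hp
  have hedge : ∀ {x m y}, (M.redirect p l r).Edge x m y → y ∉ red →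
      (x = p → m ≠ l) ∧ M.Edge x m y := fun {x m y} e hy => by
    rcases edge_redirect.1 e with ⟨-, -, rfl, -⟩ | e
    · exact absurd hr hy
    · exact e
  have hred : ∀ {x}, M.Reach M.init x → x ∈ red → (M.redirect p l r).Reach M.init x := by
    intro x hx
    induction hx with
    | refl => exact fun _ => .refl
    | @tail y z _ e ih =>
      intro hz
      obtain ⟨m, e⟩ := e
      have hy : y ∈ red := by
        by_contra hy
        exact h.succ _ _ _ hy e hz
      refine (ih hy).tail ⟨m, edge_redirect.2 (Or.inr ⟨?_, e⟩)⟩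
      rintro rfl rfl
      exact hbr (Option.some.inj (hb.symm.trans e.2) ▸ hz)
  constructor
  · exact h.init_mem
  · exact h.red_sub
  · intro x m y e
    rcases edge_redirect.1 e with ⟨-, -, rfl, -⟩ | e
    · exact h.red_sub _ hr
    · exact h.closed _ _ _ e.2
  · intro x m x' m' y hy e e'
    exact h.unique _ _ _ _ _ hy (hedge e hy).2 (hedge e' hy).2
  · intro x m y hx e
    rcases edge_redirect.1 e with ⟨rfl, -⟩ | e
    · exact absurd hp hx
    · exact h.succ _ _ _ hx e.2
  · simp
  · rintro w hw
    obtain rfl := List.mem_singleton.1 hw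
    refine ⟨h.closed _ _ _ ⟨hps, hb⟩, hbr, fun x m e => ?_⟩
    obtain ⟨hne, e⟩ := hedge e hbr
    obtain ⟨rfl, rfl⟩ := h.unique _ _ _ _ _ hbr e ⟨hps, hb⟩
    exact hne rfl rfl
  · rintro w hw
    obtain rfl := List.mem_singleton.1 hw
    exact hred ((h.cover r (h.red_sub r hr)).resolve_right (by simp)) hr
  · intro x hx
    have hx := (h.cover x hx).resolve_right (by simp)
    simp only [List.mem_singleton, exists_eq_left]
    change M.Reach M.init x at hx
    change (M.redirect p l r).Reach M.init x ∨ _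
    induction hx with
    | refl => exact Or.inl .refl
    | @tail y z _ e ih =>
      obtain ⟨m, e⟩ := e
      by_cases hym : y = p ∧ m = l
      · obtain ⟨rfl, rfl⟩ := hym
        obtain rfl := Option.some.inj (hb.symm.trans e.2)
        exact Or.inr .refl
      · have e' : (M.redirect p l r).Edge y m z :=
          edge_redirect.2 (Or.inr ⟨fun h₁ h₂ => hym ⟨h₁, h₂⟩, e⟩)
        exact (ih e.1).imp (fun hy => hy.tail ⟨m, e'⟩) fun hy => hy.tail ⟨m, e'⟩

/-- A blue state may be declared red. -/
theorem promote (h : PartialFold M red []) {p b : σ} {l : B} (hp : p ∈ red)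
    (hb : (M.tr p).lookup l = some b) (hbr : b ∉ red) : PartialFold M (b :: red) [] := by
  have hps := h.red_sub p hp
  refine ⟨List.mem_cons_of_mem _ h.init_mem, ?_, h.closed, ?_, ?_, List.nodup_nil, by simp, by simp,
    h.cover⟩
  · intro x hx
    rcases List.mem_cons.1 hx with rfl | hx
    · exact h.closed _ _ _ ⟨hps, hb⟩
    · exact h.red_sub x hx
  · exact fun x m x' m' y hy => h.unique _ _ _ _ _ fun hy' => hy (List.mem_cons_of_mem _ hy')
  · intro x m y hx e hy
    have hx' : x ∉ red := fun hx' => hx (List.mem_cons_of_mem _ hx')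
    rcases List.mem_cons.1 hy with rfl | hy
    · obtain ⟨rfl, -⟩ := h.unique _ _ _ _ _ hbr e ⟨hps, hb⟩
      exact hx' hp
    · exact h.succ _ _ _ hx' e hy

/-- If every successor of a red state is red, then all states are red. -/
theorem mem_red (h : PartialFold M red [])
    (hblue : ∀ p l b, p ∈ red → (M.tr p).lookup l = some b → b ∈ red) {x : σ}
    (hx : x ∈ M.states) : x ∈ red := by
  have hx := (h.cover x hx).resolve_right (by simp)
  induction hx with
  | refl => exact h.init_mem
  | tail _ e ih =>
    obtain ⟨m, e⟩ := e
    exact hblue _ _ _ (ih e.1) e.2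

end PartialFold

end Transducer

namespace Transducer

variable {σ A B O : Type*} [DecidableEq σ] [DecidableEq A] [DecidableEq B] [DecidableEq O]

/-! ### Sizes of the tables -/

/-- Number of transitions stored in a transducer. -/
def trSum (M : Transducer σ A B O) : ℕ := ∑ q ∈ M.states, M.trSize q

/-- Number of outputs recorded at the states outside `X`. -/
def outSum (M : Transducer σ A B O) (X : Finset σ) : ℕ := ∑ q ∈ M.states \ X, M.outSize q

theorem sum_erase_update_le {s : Finset σ} {f g : σ → ℕ} {r b : σ} (hb : b ∈ s) (hrb : r ≠ b)
    (hr : g r ≤ f r + f b) (hne : ∀ q, q ≠ r → g q = f q) :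
    ∑ q ∈ s.erase b, g q ≤ ∑ q ∈ s, f q := by
  rw [← Finset.sum_erase_add _ _ hb]
  by_cases hrs : r ∈ s
  · have hrs' : r ∈ s.erase b := Finset.mem_erase.2 ⟨hrb, hrs⟩
    rw [← Finset.sum_erase_add _ _ hrs', ← Finset.sum_erase_add _ f hrs',
      Finset.sum_congr (g := f) rfl fun q hq => hne q (Finset.ne_of_mem_erase hq)]
    linarith
  · rw [Finset.sum_congr (g := f) rfl fun q hq => hne q ?_]
    · linarith
    · rintro rfl
      exact hrs (Finset.mem_of_mem_erase hq)

theorem trSize_absorb_self_le (M : Transducer σ A B O) (r b : σ) :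
    (M.absorb r b).trSize r ≤ M.trSize r + M.trSize b := by
  simpa [trSize, absorb] using AList.length_entries_union_le (M.tr r) (M.tr b)

theorem outSize_absorb_self_le (M : Transducer σ A B O) (r b : σ) :
    (M.absorb r b).outSize r ≤ M.outSize r + M.outSize b := by
  simpa [outSize, absorb] using AList.length_entries_union_le (M.out r) (M.out b)

theorem trSize_absorb_of_ne {M : Transducer σ A B O} {r b q : σ} (h : q ≠ r) :
    (M.absorb r b).trSize q = M.trSize q := by
  rw [trSize, tr_absorb_of_ne h, trSize]

theorem outSize_absorb_of_ne {M : Transducer σ A B O} {r b q : σ} (h : q ≠ r) :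
    (M.absorb r b).outSize q = M.outSize q := by
  rw [outSize, out_absorb_of_ne h, outSize]

theorem states_absorb_sdiff (M : Transducer σ A B O) (r b : σ) (X : Finset σ) :
    (M.absorb r b).states \ X = (M.states \ X).erase b :=
  Finset.erase_sdiff_comm _ _ _

/-- The effect of absorbing states that are not red: transition tables only grow, but
no table entries are created in total. -/
structure Reduces (red : List σ) (M M' : Transducer σ A B O) : Prop where
  states_sub : M'.states ⊆ M.states
  tr_mono : ∀ q l x, (M.tr q).lookup l = some x → (M'.tr q).lookup l = some x
  trSum_le : M'.trSum ≤ M.trSum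
  outSum_le : M'.outSum ∅ ≤ M.outSum ∅
  outSum_red_le : M'.outSum red.toFinset ≤ M.outSum red.toFinset

namespace Reduces

variable {M M' M'' : Transducer σ A B O} {red : List σ} {ws : List (σ × σ)} {r b : σ}

theorem refl (red : List σ) (M : Transducer σ A B O) : Reduces red M M :=
  ⟨Finset.Subset.refl _, fun _ _ _ h => h, le_rfl, le_rfl, le_rfl⟩

theorem trans (h : Reduces red M M') (h' : Reduces red M' M'') : Reduces red M M'' :=
  ⟨h'.states_sub.trans h.states_sub,
    fun q l x hx => h'.tr_mono q l x (h.tr_mono q l x hx),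
    h'.trSum_le.trans h.trSum_le, h'.outSum_le.trans h.outSum_le,
    h'.outSum_red_le.trans h.outSum_red_le⟩

theorem outSum_absorb_le {X : Finset σ} (hb : b ∈ M.states) (hbX : b ∉ X) (hrb : r ≠ b) :
    (M.absorb r b).outSum X ≤ M.outSum X := by
  rw [outSum, states_absorb_sdiff]
  exact sum_erase_update_le (Finset.mem_sdiff.2 ⟨hb, hbX⟩) hrb (outSize_absorb_self_le M r b)
    fun q hq => outSize_absorb_of_ne hq

theorem absorb (h : PartialFold M red ((r, b) :: ws)) : Reduces red M (M.absorb r b) := by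
  obtain ⟨hbs, hbr, -⟩ := h.pending _ List.mem_cons_self
  exact ⟨Finset.erase_subset _ _, fun _ _ _ => lookup_tr_absorb,
    sum_erase_update_le hbs h.ne (trSize_absorb_self_le M r b) fun q hq => trSize_absorb_of_ne hq,
    outSum_absorb_le hbs (by simp) h.ne, outSum_absorb_le hbs (by simpa using hbr) h.ne⟩

end Reduces

/-! ### The folding operation -/

namespace PartialFold

variable {M : Transducer σ A B O} {red : List σ} {ws : List (σ × σ)} {r b : σ}

/-- Below the red states no pair is ever skipped by the folding. -/
theorem fold_cons (h : PartialFold M red ((r, b) :: ws)) :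
    M.fold ((r, b) :: ws) =
      if M.Compatible r b then
        (((M.absorb r b).fold (M.implied r b ++ ws)).1,
          (1 + M.outSize b) + (M.outSize b + M.trSize b) +
            ((M.absorb r b).fold (M.implied r b ++ ws)).2)
      else (none, 1 + M.outSize b) := by
  rw [fold, if_pos ⟨(h.pending _ List.mem_cons_self).1, h.ne⟩]

/-- Induction along the folding operation. -/
theorem fold_induction {P : Transducer σ A B O → List (σ × σ) → Prop}
    (nil : ∀ M, PartialFold M red [] → P M [])
    (compatible : ∀ M r b ws, PartialFold M red ((r, b) :: ws) → M.Compatible r b →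
      P (M.absorb r b) (M.implied r b ++ ws) → P M ((r, b) :: ws))
    (incompatible : ∀ M r b ws, PartialFold M red ((r, b) :: ws) → ¬ M.Compatible r b →
      P M ((r, b) :: ws))
    (h : PartialFold M red ws) : P M ws := by
  generalize hn : M.states.card = n
  induction n using Nat.strong_induction_on generalizing M ws with
  | _ n ih =>
    rcases ws with _ | ⟨⟨r, b⟩, ws⟩
    · exact nil M h
    · by_cases hc : M.Compatible r b
      · refine compatible M r b ws h hc (ih _ ?_ h.absorb rfl)
        rw [← hn]
        exact Finset.card_erase_lt_of_mem (h.pending _ List.mem_cons_self).1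
      · exact incompatible M r b ws h hc

open Classical in
/-- Total size of the states that are not reachable from the initial state.  It bounds the time of
the folding because these states are absorbed with their original tables, while states that have
gained entries are never absorbed in the same folding. -/
noncomputable def detachedSize (M : Transducer σ A B O) : ℕ :=
  ∑ q ∈ M.states with ¬ M.Reach M.init q, (1 + 2 * M.outSize q + 2 * M.trSize q)

theorem detachedSize_le (M : Transducer σ A B O) :
    detachedSize M ≤ M.states.card + 2 * M.outSum ∅ + 2 * M.trSum := by
  classical
  refine (Finset.sum_le_sum_of_subset (Finset.filter_subset _ _)).trans (le_of_eq ?_)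
  simp [outSum, trSum, Finset.sum_add_distrib, Finset.mul_sum]

theorem detachedSize_absorb (h : PartialFold M red ((r, b) :: ws)) :
    detachedSize (M.absorb r b) + (1 + 2 * M.outSize b + 2 * M.trSize b) ≤ detachedSize M := by
  classical
  obtain ⟨hbs, hbr, hbe⟩ := h.pending _ List.mem_cons_self
  have hr : M.Reach M.init r := h.target _ List.mem_cons_self
  have hb : ¬ M.Reach M.init b := by
    intro hb
    cases hb with
    | refl => exact h.init_ne rfl
    | tail _ e => exact hbe _ _ e.choose_spec
  have hmem : b ∈ M.states.filter fun q => ¬ M.Reach M.init q := Finset.mem_filter.2 ⟨hbs, hb⟩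
  rw [detachedSize, detachedSize, ← Finset.sum_erase_add _ _ hmem]
  refine Nat.add_le_add_right ?_ _
  rw [Finset.sum_congr rfl fun q hq => ?_]
  · refine Finset.sum_le_sum_of_subset fun q hq => ?_
    obtain ⟨hq, hn⟩ := Finset.mem_filter.1 hq
    obtain ⟨hqb, hqs⟩ := Finset.mem_erase.1 hq
    exact Finset.mem_erase.2 ⟨hqb, Finset.mem_filter.2 ⟨hqs, fun hq => hn
      (Reach.absorb (r := r) hbe h.init_ne hq).1⟩⟩
  · have hqr : q ≠ r := by
      rintro rfl
      exact (Finset.mem_filter.1 hq).2 (Reach.absorb (r := q) hbe h.init_ne hr).1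
    rw [outSize_absorb_of_ne hqr, trSize_absorb_of_ne hqr]

/-- Each absorbed state leaves the detached part.  Its transitions are counted twice in
`detachedSize`, once for their inspection and once for the pending merges they give rise to. -/
theorem fold_time_le (h : PartialFold M red ws) :
    (M.fold ws).2 ≤ 1 + ws.length + detachedSize M := by
  refine fold_induction (P := fun M ws => (M.fold ws).2 ≤ 1 + ws.length + detachedSize M)
    ?_ ?_ ?_ h
  · intro M h
    simp [fold]
  · intro M r b ws h hc ih
    rw [h.fold_cons, if_pos hc]
    have h₁ := h.detachedSize_absorb
    have h₂ := length_implied_le (M := M) (r := r) (b := b)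
    rw [List.length_append] at ih
    rw [List.length_cons]
    dsimp only
    omega
  · intro M r b ws h hc
    rw [h.fold_cons, if_neg hc]
    have := h.detachedSize_absorb
    dsimp only
    omega

theorem fold_some {M' : Transducer σ A B O} (h : PartialFold M red ws)
    (hM : (M.fold ws).1 = some M') : PartialFold M' red [] ∧ Reduces red M M' := by
  refine fold_induction (P := fun M ws => (M.fold ws).1 = some M' →
    PartialFold M' red [] ∧ Reduces red M M') ?_ ?_ ?_ h hM
  · intro M h hM
    rw [fold] at hM
    obtain rfl := Option.some.inj hM
    exact ⟨h, .refl _ _⟩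
  · intro M r b ws h hc ih hM
    rw [h.fold_cons, if_pos hc] at hM
    exact (ih hM).imp_right (Reduces.absorb h).trans
  · intro M r b ws h hc hM
    rw [h.fold_cons, if_neg hc] at hM
    cases hM

end PartialFold

/-! ### Merging a blue state into a red one -/

section merge

variable {M M' : Transducer σ A B O} {red : List σ} {p r b : σ} {l : B}

/-- The redirected transition exists already, so redirecting does not create a table entry. -/
theorem trSum_redirect (hb : (M.tr p).lookup l = some b) : (M.redirect p l r).trSum = M.trSum := by
  refine Finset.sum_congr rfl fun q _ => ?_
  by_cases hq : q = p
  · subst hq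
    have hl : l ∈ M.tr q := AList.lookup_isSome.1 (by rw [hb]; rfl)
    have := AList.length_entries_insert_of_mem r hl
    simpa [trSize, redirect] using this
  · simp [trSize, redirect, hq]

variable (h : PartialFold M red []) (hp : p ∈ red) (hb : (M.tr p).lookup l = some b)
  (hbr : b ∉ red) (hr : r ∈ red)

include h hp hb hbr hr

theorem merge_time_le : (M.merge p l b r).2 ≤ 2 + M.states.card + 2 * M.outSum ∅ + 2 * M.trSum := by
  have h₁ := (h.redirect hp hb hbr hr).fold_time_le
  have h₂ := PartialFold.detachedSize_le (M.redirect p l r)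
  rw [trSum_redirect hb] at h₂
  change _ ≤ M.states.card + 2 * M.outSum ∅ + _ at h₂
  rw [List.length_singleton] at h₁
  rw [merge]
  omega

theorem merge_of_not_compatible (hc : ¬ M.Compatible r b) :
    M.merge p l b r = (none, 1 + M.outSize b) := by
  rw [merge, (h.redirect hp hb hbr hr).fold_cons, if_neg (by exact hc)]
  rfl

/-- A merge that succeeds has absorbed at least the blue state. -/
theorem merge_some (hM : (M.merge p l b r).1 = some M') :
    PartialFold M' red [] ∧ Reduces red ((M.redirect p l r).absorb r b) M' := by
  have h₁ := h.redirect hp hb hbr hr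
  rw [merge, h₁.fold_cons] at hM
  split_ifs at hM
  exact h₁.absorb.fold_some hM

end merge

/-- The properties of a completed merge of a blue state `b`, entered from `p` under `l`, into some
red state. -/
structure Merged (red : List σ) (M : Transducer σ A B O) (p : σ) (l : B) (b : σ)
    (M' : Transducer σ A B O) : Prop where
  partialFold : PartialFold M' red []
  states_sub : M'.states ⊆ M.states.erase b
  tr_mono : ∀ q m x, (M.tr q).lookup m = some x → (q, m) ≠ (p, l) → (M'.tr q).lookup m = some x
  tr_red : ∃ r ∈ red, (M'.tr p).lookup l = some r
  trSum_le : M'.trSum ≤ M.trSum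
  outSum_le : M'.outSum ∅ ≤ M.outSum ∅
  outSum_red_le : M'.outSum red.toFinset + M.outSize b ≤ M.outSum red.toFinset

theorem Merged.of_merge {M M' : Transducer σ A B O} {red : List σ} {p r b : σ} {l : B}
    (h : PartialFold M red []) (hp : p ∈ red) (hb : (M.tr p).lookup l = some b)
    (hbr : b ∉ red) (hr : r ∈ red) (hM : (M.merge p l b r).1 = some M') :
    Merged red M p l b M' := by
  obtain ⟨h₁, h₂⟩ := merge_some h hp hb hbr hr hM
  have hf := h.redirect hp hb hbr hr
  have h₃ := Reduces.absorb hf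
  have h₄ := h₃.trans h₂
  have hbs := h.closed _ _ _ ⟨h.red_sub p hp, hb⟩
  refine ⟨h₁, h₂.states_sub, ?_, ⟨r, hr, ?_⟩, ?_, h₄.outSum_le, ?_⟩
  · intro q m x hx hne
    refine h₄.tr_mono q m x ?_
    by_cases hq : q = p
    · subst hq
      have hm : m ≠ l := fun hm => hne (by rw [hm])
      simpa [redirect, AList.lookup_insert_ne hm] using hx
    · simpa [redirect, hq] using hx
  · exact h₄.tr_mono p l r (by simp [redirect, AList.lookup_insert])
  · rw [← trSum_redirect (r := r) hb]
    exact h₄.trSum_le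
  · refine (Nat.add_le_add_right h₂.outSum_red_le _).trans ?_
    have hmem : b ∈ M.states \ red.toFinset := by simp [hbs, hbr]
    have hne : ∀ q ∈ (M.states \ red.toFinset).erase b, q ≠ r := by
      rintro q hq rfl
      simp [hr] at hq
    rw [outSum, outSum, states_absorb_sdiff, ← Finset.sum_erase_add _ _ hmem]
    refine Nat.add_le_add_right (le_of_eq (Finset.sum_congr rfl fun q hq => ?_)) _
    rw [outSize_absorb_of_ne (hne q hq)]
    rfl

end Transducer

namespace Transducer

variable {σ A B O : Type*} [DecidableEq σ] [DecidableEq A] [DecidableEq B] [DecidableEq O]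

/-! ### The rounds of the main loop -/

/-- A failing attempt costs `1 + 2 * K` for the folding and its undoing; the successful one, which
ends the loop, takes the time of the folding once more. -/
theorem tryRed_time_le {M : Transducer σ A B O} {p b : σ} {l : B} {rs : List σ} {K : ℕ}
    (h : ∀ r ∈ rs, (M.merge p l b r).2 ≤ K) :
    (M.tryRed p l b rs).2 ≤ 1 + rs.length * (1 + 2 * K) + K := by
  induction rs with
  | nil => simp [tryRed]
  | cons r rs ih =>
    have hr := h r List.mem_cons_self
    have ih := ih fun x hx => h x (List.mem_cons_of_mem _ hx)
    rw [tryRed, List.length_cons, Nat.succ_mul]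
    split <;> rename_i t ht <;> rw [ht] at hr <;> dsimp only at hr ⊢ <;> omega

theorem exists_merge_of_tryRed {M M' : Transducer σ A B O} {p b : σ} {l : B} {rs : List σ} {t : ℕ}
    (h : M.tryRed p l b rs = (some M', t)) : ∃ r ∈ rs, (M.merge p l b r).1 = some M' := by
  induction rs generalizing t with
  | nil => cases h
  | cons r rs ih =>
    rw [tryRed] at h
    split at h
    · rename_i t' ht
      cases h
      exact ⟨r, List.mem_cons_self, by rw [ht]⟩
    · rename_i t' ht
      obtain ⟨x, hx, hx'⟩ := ih (Prod.ext (Prod.mk.inj h).1 rfl)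
      exact ⟨x, List.mem_cons_of_mem _ hx, hx'⟩

end Transducer

namespace DBRPNI

open Transducer

variable {σ A B O : Type*} [DecidableEq σ] [DecidableEq A] [DecidableEq B] [DecidableEq O]

/-- The invariant of the main loop; `T` bounds the number of states and of transitions, `K` the
number of recorded outputs. -/
structure Config.Valid (c : Config σ A B O) (T K : ℕ) : Prop where
  nodup : c.red.Nodup
  partialFold : PartialFold c.mach c.red []
  card_le : c.mach.states.card ≤ T
  trSum_le : c.mach.trSum ≤ T
  outSum_le : c.mach.outSum ∅ ≤ K

/-- Number of states that are not red.  It decreases in every round. -/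
def Config.rest (c : Config σ A B O) : ℕ := (c.mach.states \ c.red.toFinset).card

namespace Config.Valid

variable {c d : Config σ A B O} {T K t : ℕ}

theorem red_length_le (h : c.Valid T K) : c.red.length ≤ T := by
  rw [← List.toFinset_card_of_nodup h.nodup]
  refine (Finset.card_le_card fun x hx => ?_).trans h.card_le
  exact h.partialFold.red_sub x (List.mem_toFinset.1 hx)

theorem blueTime_le (h : c.Valid T K) : c.blueTime ≤ 1 + 2 * T := by
  have h₁ : (c.red.map fun r => 1 + c.mach.trSize r).sum
      ≤ ∑ q ∈ c.mach.states, (1 + c.mach.trSize q) := by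
    rw [← List.sum_toFinset _ h.nodup]
    exact Finset.sum_le_sum_of_subset fun x hx =>
      h.partialFold.red_sub x (List.mem_toFinset.1 hx)
  rw [Finset.sum_add_distrib, Finset.sum_const, smul_eq_mul, mul_one] at h₁
  have h₂ := h.card_le
  have h₃ := h.trSum_le
  rw [trSum] at h₃
  rw [Config.blueTime]
  omega

theorem merged {p b : σ} {l : B} {rs : List σ} {M' : Transducer σ A B O} (h : c.Valid T K)
    (hb : c.Blue p l b) (hrs : rs.Perm c.red) (ht : c.mach.tryRed p l b rs = (some M', t)) :
    Merged c.red c.mach p l b M' := by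
  obtain ⟨r, hr, hM⟩ := exists_merge_of_tryRed ht
  exact .of_merge h.partialFold hb.1 hb.2.1 hb.2.2 (hrs.mem_iff.1 hr) hM

theorem merge_time_le {p b r : σ} {l : B} (h : c.Valid T K) (hb : c.Blue p l b)
    (hr : r ∈ c.red) : (c.mach.merge p l b r).2 ≤ 2 + 3 * T + 2 * K := by
  have h₁ := Transducer.merge_time_le h.partialFold hb.1 hb.2.1 hb.2.2 hr
  have h₂ := h.card_le
  have h₃ := h.trSum_le
  have h₄ := h.outSum_le
  omega

theorem step (h : c.Valid T K) (hs : Step c t d) : d.Valid T K := by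
  cases hs with
  | merge hb hrs ht =>
    have hm := h.merged hb hrs ht
    exact ⟨h.nodup, hm.partialFold,
      (Finset.card_le_card (hm.states_sub.trans (Finset.erase_subset _ _))).trans h.card_le,
      hm.trSum_le.trans h.trSum_le, hm.outSum_le.trans h.outSum_le⟩
  | promote hb hrs ht =>
    exact ⟨List.nodup_cons.2 ⟨hb.2.2, h.nodup⟩, h.partialFold.promote hb.1 hb.2.1 hb.2.2,
      h.card_le, h.trSum_le, h.outSum_le⟩

theorem run (h : c.Valid T K) (hr : Run c t d) : d.Valid T K := by
  induction hr with
  | refl => exact h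
  | tail _ hs ih => exact ih.step hs

theorem rest_lt (h : c.Valid T K) (hs : Step c t d) : d.rest < c.rest := by
  have key : ∀ {p l b}, c.Blue p l b → b ∈ c.mach.states \ c.red.toFinset := fun {p l b} hb => by
    simpa [hb.2.2] using h.partialFold.closed _ _ _ ⟨h.partialFold.red_sub _ hb.1, hb.2.1⟩
  cases hs with
  | @merge p l b _ _ _ hb hrs ht =>
    have hm := h.merged hb hrs ht
    refine (Finset.card_le_card fun x hx => ?_).trans_lt (Finset.card_erase_lt_of_mem (key hb))
    obtain ⟨hx, hx'⟩ := Finset.mem_sdiff.1 hx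
    obtain ⟨hxb, hx⟩ := Finset.mem_erase.1 (hm.states_sub hx)
    exact Finset.mem_erase.2 ⟨hxb, Finset.mem_sdiff.2 ⟨hx, hx'⟩⟩
  | @promote p l b _ _ hb hrs ht =>
    refine (Finset.card_le_card fun x hx => ?_).trans_lt (Finset.card_erase_lt_of_mem (key hb))
    simpa [and_left_comm, not_or] using hx

theorem exists_returnsFrom (h : c.Valid T K) : ∃ M t, ReturnsFrom c M t := by
  induction hn : c.rest using Nat.strong_induction_on generalizing c with
  | _ n ih =>
    by_cases hb : ∀ p l b, ¬ c.Blue p l b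
    · exact ⟨_, _, c, 0, .refl c, hb, rfl, rfl⟩
    · push Not at hb
      obtain ⟨p, l, b, hb⟩ := hb
      obtain ⟨d, t, hs⟩ : ∃ d t, Step c t d := by
        rcases ht : c.mach.tryRed p l b c.red with ⟨_ | M, t⟩
        · exact ⟨_, _, .promote hb (.refl _) ht⟩
        · exact ⟨_, _, .merge hb (.refl _) ht⟩
      obtain ⟨M, t', e, s, hr, he, rfl, rfl⟩ := ih _ (hn ▸ h.rest_lt hs) (h.step hs) rfl
      have hrun : ∀ {s e}, Run d s e → ∃ s', Run c s' e := fun {s e} hr => by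
        induction hr with
        | refl => exact ⟨_, .tail (.refl c) hs⟩
        | tail _ hs ih => exact ⟨_, ih.choose_spec.tail hs⟩
      exact ⟨_, _, e, _, (hrun hr).choose_spec, he, rfl, rfl⟩

/-- A round scans the transitions of the red states and makes at most `T` attempts, each with a
folding of time at most `2 + 3 * T + 2 * K`. -/
theorem step_time_le (h : c.Valid T K) (hs : Step c t d) :
    t ≤ 3 + 2 * T + T * (1 + 2 * (2 + 3 * T + 2 * K)) + (2 + 3 * T + 2 * K) := by
  have key : ∀ {p l b rs}, c.Blue p l b → rs.Perm c.red → (c.mach.tryRed p l b rs).2 ≤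
      1 + T * (1 + 2 * (2 + 3 * T + 2 * K)) + (2 + 3 * T + 2 * K) := fun {p l b rs} hb hrs => by
    refine (tryRed_time_le fun r hr => h.merge_time_le hb (hrs.mem_iff.1 hr)).trans ?_
    have := hrs.length_eq.trans_le h.red_length_le
    gcongr
  have hbt := h.blueTime_le
  cases hs with
  | merge hb hrs ht =>
    have := key hb hrs
    rw [ht] at this
    dsimp only at this
    omega
  | promote hb hrs ht =>
    have := key hb hrs
    rw [ht] at this
    dsimp only at this
    omega

theorem run_time_le (h : c.Valid T K) (hr : Run c t d) {X : ℕ}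
    (hX : ∀ {c d : Config σ A B O} {t}, c.Valid T K → Step c t d → t ≤ X) :
    t + d.rest * X ≤ c.rest * X := by
  induction hr with
  | refl => simp
  | @tail d e s t hr hs ih =>
    have h₁ := (h.run hr).rest_lt hs
    have h₂ := hX (h.run hr) hs
    have h₃ : (e.rest + 1) * X ≤ d.rest * X := Nat.mul_le_mul_right _ h₁
    rw [Nat.succ_mul] at h₃
    omega

theorem time_le {F : ℕ} {M : Transducer σ A B O} (h : c.Valid T (T * F)) (hT : 0 < T) (hF : 0 < F)
    (hr : ReturnsFrom c M t) : t ≤ 60 * (T ^ 3 * F) := by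
  obtain ⟨d, s, hr, -, -, rfl⟩ := hr
  have h₁ := h.run_time_le hr fun h hs => h.step_time_le hs
  have h₂ := (h.run hr).blueTime_le
  have h₃ : c.rest ≤ T := (Finset.card_le_card Finset.sdiff_subset).trans h.card_le
  have h₄ := Nat.mul_le_mul_right
    (3 + 2 * T + T * (1 + 2 * (2 + 3 * T + 2 * (T * F))) + (2 + 3 * T + 2 * (T * F))) h₃
  obtain ⟨T, rfl⟩ : ∃ n, T = n + 1 := ⟨T - 1, by omega⟩
  obtain ⟨F, rfl⟩ : ∃ n, F = n + 1 := ⟨F - 1, by omega⟩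
  have h₅ : s + d.blueTime ≤ (T + 1) * (3 + 2 * (T + 1) + (T + 1) *
      (1 + 2 * (2 + 3 * (T + 1) + 2 * ((T + 1) * (F + 1)))) +
        (2 + 3 * (T + 1) + 2 * ((T + 1) * (F + 1)))) + (1 + 2 * (T + 1)) := by
    omega
  refine h₅.trans ?_
  -- both sides are polynomials with natural coefficients, compared coefficientwise
  ring_nf
  linarith [Nat.zero_le (T ^ 3 * F), Nat.zero_le (T ^ 2 * F), Nat.zero_le (T * F),
    Nat.zero_le (T ^ 3), Nat.zero_le (T ^ 2)]

end Config.Valid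

end DBRPNI

namespace Transducer

variable {A B O : Type*} [DecidableEq A] [DecidableEq B] [DecidableEq O]

/-! ### The prefix tree transducer -/

/-- The states are the nodes of a tree of words, the transitions are its edges. -/
structure IsPrefixTree (M : Transducer (List B) A B O) : Prop where
  init_eq : M.init = []
  nil_mem : [] ∈ M.states
  prefix_mem : ∀ w l, w ++ [l] ∈ M.states → w ∈ M.states
  lookup_tr : ∀ w l x, (M.tr w).lookup l = some x ↔ x = w ++ [l] ∧ w ++ [l] ∈ M.states

section pttStep

variable {M : Transducer (List B) A B O} {w : List B}

theorem IsPrefixTree.pttStep_snd (h : IsPrefixTree M) (e : (A ⊕ B) × O) :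
    (pttStep (M, w) e).2 = w ++ Sample.betaWord [e] := by
  obtain ⟨a | l, o⟩ := e
  · simp [pttStep, Sample.betaWord]
  · simp only [pttStep, Sample.betaWord]
    cases hx : (M.tr w).lookup l with
    | none => rfl
    | some x => exact ((h.lookup_tr _ _ _).1 hx).1

theorem IsPrefixTree.mem_states_pttStep (h : IsPrefixTree M) (hw : w ∈ M.states)
    (e : (A ⊕ B) × O) (x : List B) :
    x ∈ (pttStep (M, w) e).1.states ↔ x ∈ M.states ∨ x = (pttStep (M, w) e).2 := by
  obtain ⟨a | l, o⟩ := e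
  · simp only [pttStep]
    exact ⟨Or.inl, by rintro (h | rfl) <;> assumption⟩
  · simp only [pttStep]
    cases hx : (M.tr w).lookup l with
    | none => simp [or_comm]
    | some y =>
      obtain ⟨rfl, hy⟩ := (h.lookup_tr _ _ _).1 hx
      exact ⟨Or.inl, by rintro (h | rfl) <;> assumption⟩

theorem IsPrefixTree.pttStep (h : IsPrefixTree M) (hw : w ∈ M.states) (e : (A ⊕ B) × O) :
    IsPrefixTree (pttStep (M, w) e).1 := by
  obtain ⟨a | l, o⟩ := e
  · exact ⟨h.init_eq, h.nil_mem, h.prefix_mem, h.lookup_tr⟩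
  · simp only [Transducer.pttStep]
    cases hl : (M.tr w).lookup l with
    | some y => exact h
    | none =>
      refine ⟨h.init_eq, Finset.mem_insert_of_mem h.nil_mem, ?_, ?_⟩
      · intro v m hv
        refine Finset.mem_insert_of_mem ?_
        rcases Finset.mem_insert.1 hv with hv | hv
        · exact (List.append_inj_left' hv rfl) ▸ hw
        · exact h.prefix_mem v m hv
      · intro v m x
        by_cases hv : v = w
        · subst hv
          by_cases hm : m = l
          · subst hm
            simp [AList.lookup_insert, eq_comm]
          · simp [AList.lookup_insert_ne hm, h.lookup_tr, hm]
        · have : v ++ [m] ≠ w ++ [l] := fun hvw => hv (List.append_inj_left' hvw rfl)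
          simp [hv, h.lookup_tr]

theorem lookup_out_pttStep (e : (A ⊕ B) × O) (x : List B) (a : A) (o : O) :
    ((pttStep (M, w) e).1.out x).lookup a = some o ↔
      x = w ∧ e = (Sum.inl a, o) ∨
        (¬ ∃ o', x = w ∧ e = (Sum.inl a, o')) ∧ (M.out x).lookup a = some o := by
  obtain ⟨a' | l, o'⟩ := e
  · by_cases hx : x = w
    · subst hx
      by_cases ha : a = a'
      · subst ha
        simp [pttStep, AList.lookup_insert]
      · simp [pttStep, AList.lookup_insert_ne ha, Ne.symm ha]
    · simp [pttStep, hx]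
  · simp only [pttStep]
    cases (M.tr w).lookup l <;> simp

end pttStep

theorem betaWord_cons (e : (A ⊕ B) × O) (s : Sample A B O) :
    Sample.betaWord (e :: s) = Sample.betaWord [e] ++ Sample.betaWord s := by
  simp only [Sample.betaWord, ← List.filterMap_append, List.singleton_append]

/-- The effect of processing a sample `s` from the state `w`. -/
theorem foldl_pttStep (s : Sample A B O) {M : Transducer (List B) A B O} {w : List B}
    (h : IsPrefixTree M) (hw : w ∈ M.states) :
    IsPrefixTree (s.foldl pttStep (M, w)).1 ∧
    (∀ x, x ∈ (s.foldl pttStep (M, w)).1.states ↔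
      x ∈ M.states ∨ ∃ i, w ++ Sample.betaWord (s.take i) = x) ∧
    (∀ x a o, ((s.foldl pttStep (M, w)).1.out x).lookup a = some o →
      (M.out x).lookup a = some o ∨
        ∃ i : ℕ, s[i]? = some (Sum.inl a, o) ∧ w ++ Sample.betaWord (s.take i) = x) ∧
    (∀ x a, (∃ o, (M.out x).lookup a = some o) ∨
        (∃ (i : ℕ) (o : O), s[i]? = some (Sum.inl a, o) ∧ w ++ Sample.betaWord (s.take i) = x) →
      ∃ o, ((s.foldl pttStep (M, w)).1.out x).lookup a = some o) := by
  induction s generalizing M w with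
  | nil =>
    refine ⟨h, fun x => ⟨Or.inl, ?_⟩, fun x a o => Or.inl, fun x a => ?_⟩
    · rintro (hx | ⟨i, rfl⟩)
      · exact hx
      · simpa [Sample.betaWord] using hw
    · rintro (hx | ⟨i, o, hi, -⟩)
      · exact hx
      · simp at hi
  | cons e s ih =>
    have hw' : (pttStep (M, w) e).2 ∈ (pttStep (M, w) e).1.states :=
      (h.mem_states_pttStep hw e _).2 (Or.inr rfl)
    obtain ⟨h₁, h₂, h₃, h₄⟩ := ih (h.pttStep hw e) hw'
    have hsnd := h.pttStep_snd (w := w) e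
    rw [List.foldl_cons]
    have hb : ∀ i, (pttStep (M, w) e).2 ++ Sample.betaWord (s.take i)
        = w ++ Sample.betaWord ((e :: s).take (i + 1)) := fun i => by
      rw [hsnd, List.take_succ_cons, betaWord_cons e (s.take i), List.append_assoc]
    refine ⟨h₁, fun x => ?_, fun x a o hx => ?_, fun x a hx => ?_⟩
    · rw [h₂, h.mem_states_pttStep hw, ← Nat.or_exists_add_one
        (p := fun i => w ++ Sample.betaWord ((e :: s).take i) = x)]
      simp only [hb]
      constructor
      · rintro ((hx | rfl) | hx)
        · exact Or.inl hx
        · exact Or.inr (Or.inr ⟨0, by rw [← hb]; simp [Sample.betaWord]⟩)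
        · exact Or.inr (Or.inr hx)
      · rintro (hx | hx | hx)
        · exact Or.inl (Or.inl hx)
        · refine Or.inl (Or.inl ?_)
          rw [← hx]
          simpa [Sample.betaWord] using hw
        · exact Or.inr hx
    · rcases h₃ x a o hx with hx | ⟨i, hi, hx⟩
      · rcases (lookup_out_pttStep e x a o).1 hx with ⟨rfl, rfl⟩ | ⟨-, hx⟩
        · exact Or.inr ⟨0, by simp, by simp [Sample.betaWord]⟩
        · exact Or.inl hx
      · exact Or.inr ⟨i + 1, by simpa using hi, (hb i).symm.trans hx⟩
    · refine h₄ x a ?_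
      by_cases he : ∃ o', x = w ∧ e = (Sum.inl a, o')
      · exact Or.inl ⟨he.choose, (lookup_out_pttStep e x a _).2 (Or.inl he.choose_spec)⟩
      rcases hx with ⟨o, hx⟩ | ⟨i, o, hi, hx⟩
      · exact Or.inl ⟨o, (lookup_out_pttStep e x a o).2 (Or.inr ⟨he, hx⟩)⟩
      · cases i with
        | zero => exact absurd ⟨o, by simpa [Sample.betaWord] using hx.symm, by simpa using hi⟩ he
        | succ i => exact Or.inr ⟨i, o, by simpa using hi, (hb i).trans hx⟩

/-- The effect of processing several samples. -/
theorem foldl_foldl_pttStep (S : List (Sample A B O)) {M : Transducer (List B) A B O}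
    (h : IsPrefixTree M) :
    let M' := S.foldl (fun M s => (s.foldl pttStep (M, M.init)).1) M
    IsPrefixTree M' ∧
    (∀ x, x ∈ M'.states ↔ x ∈ M.states ∨ ∃ s ∈ S, ∃ i, Sample.betaWord (s.take i) = x) ∧
    (∀ x a o, (M'.out x).lookup a = some o →
      (M.out x).lookup a = some o ∨ (x, a, o) ∈ observed S) ∧
    (∀ x a, (∃ o, (M.out x).lookup a = some o) ∨ (∃ o, (x, a, o) ∈ observed S) →
      ∃ o, (M'.out x).lookup a = some o) := by
  induction S generalizing M with
  | nil => exact ⟨h, by simp, fun _ _ _ => Or.inl, by simp [observed]⟩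
  | cons s S ih =>
    obtain ⟨g₁, g₂, g₃, g₄⟩ := foldl_pttStep s h h.nil_mem
    rw [← h.init_eq] at g₁ g₂ g₃ g₄
    obtain ⟨h₁, h₂, h₃, h₄⟩ := ih g₁
    rw [List.foldl_cons]
    rw [h.init_eq] at g₂ g₃ g₄
    simp only [List.nil_append] at g₂ g₃ g₄
    refine ⟨h₁, fun x => ?_, fun x a o hx => ?_, fun x a hx => ?_⟩
    · rw [h₂, h.init_eq, g₂]
      simp [or_assoc]
    · rcases h₃ x a o hx with hx | ⟨s', hs', hx⟩
      · rw [h.init_eq] at hx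
        rcases g₃ x a o hx with hx | ⟨i, hi, hx⟩
        · exact Or.inl hx
        · exact Or.inr ⟨s, List.mem_cons_self, i, hi, hx⟩
      · exact Or.inr ⟨s', List.mem_cons_of_mem _ hs', hx⟩
    · refine h₄ x a ?_
      rw [h.init_eq]
      rcases hx with hx | ⟨o, s', hs', i, hi, hx⟩
      · exact Or.inl (g₄ x a (Or.inl hx))
      · rcases List.mem_cons.1 hs' with rfl | hs'
        · exact Or.inl (g₄ x a (Or.inr ⟨i, o, hi, hx⟩))
        · exact Or.inr ⟨o, s', hs', i, hi, hx⟩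

theorem isPrefixTree_empty : IsPrefixTree
    ({ states := {[]}, init := [], tr := fun _ => ∅, out := fun _ => ∅ } :
      Transducer (List B) A B O) :=
  ⟨rfl, by simp, by simp, by simp⟩

theorem isPrefixTree_ptt (S : List (Sample A B O)) : IsPrefixTree (ptt S) :=
  (foldl_foldl_pttStep S isPrefixTree_empty).1

theorem mem_states_ptt {S : List (Sample A B O)} {x : List B} :
    x ∈ (ptt S).states ↔ x = [] ∨ ∃ s ∈ S, ∃ i, Sample.betaWord (s.take i) = x := by
  simpa [ptt] using (foldl_foldl_pttStep S isPrefixTree_empty).2.1 x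

theorem observed_of_lookup_ptt {S : List (Sample A B O)} {x : List B} {a : A} {o : O}
    (h : ((ptt S).out x).lookup a = some o) : (x, a, o) ∈ observed S := by
  simpa [ptt] using (foldl_foldl_pttStep S isPrefixTree_empty).2.2.1 x a o h

theorem exists_lookup_ptt {S : List (Sample A B O)} {x : List B} {a : A} {o : O}
    (h : (x, a, o) ∈ observed S) : ∃ o', ((ptt S).out x).lookup a = some o' :=
  (foldl_foldl_pttStep S isPrefixTree_empty).2.2.2 x a (Or.inr ⟨o, h⟩)

namespace IsPrefixTree

variable {M : Transducer (List B) A B O}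

theorem partialFold (h : IsPrefixTree M) : PartialFold M [M.init] [] := by
  refine ⟨by simp, ?_, ?_, ?_, ?_, List.nodup_nil, by simp, by simp, ?_⟩
  · simpa [h.init_eq] using h.nil_mem
  · rintro p l q ⟨-, hq⟩
    obtain ⟨rfl, hq'⟩ := (h.lookup_tr _ _ _).1 hq
    exact hq'
  · rintro p l p' l' q - ⟨-, hq⟩ ⟨-, hq'⟩
    obtain ⟨rfl, -⟩ := (h.lookup_tr _ _ _).1 hq
    have := ((h.lookup_tr _ _ _).1 hq').1
    exact ⟨List.append_inj_left' this rfl, by simpa using List.append_inj_right' this rfl⟩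
  · rintro p l q - ⟨-, hq⟩
    obtain ⟨rfl, -⟩ := (h.lookup_tr _ _ _).1 hq
    simp [h.init_eq]
  · intro x hx
    refine Or.inl ?_
    induction x using List.reverseRecOn with
    | nil => rw [h.init_eq]; exact .refl
    | append_singleton w l ih =>
      have hw := h.prefix_mem w l hx
      exact (ih hw).tail ⟨l, hw, (h.lookup_tr _ _ _).2 ⟨rfl, hx⟩⟩

/-- A tree has fewer edges than nodes. -/
theorem trSum_le (h : IsPrefixTree M) : M.trSum ≤ M.states.card := by
  have hsize : ∀ q, M.trSize q = (M.tr q).keys.toFinset.card := fun q => by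
    rw [List.toFinset_card_of_nodup (M.tr q).keys_nodup]
    simp [trSize, AList.keys, List.keys]
  rw [trSum, Finset.sum_congr rfl fun q _ => hsize q, ← Finset.card_sigma]
  refine Finset.card_le_card_of_injOn (fun x => x.1 ++ [x.2]) ?_ ?_
  · rintro ⟨q, l⟩ hx
    have hl : l ∈ M.tr q := AList.mem_keys.2 (by simpa using (Finset.mem_sigma.1 hx).2)
    obtain ⟨x, hx⟩ := Option.isSome_iff_exists.1 (AList.lookup_isSome.2 hl)
    exact ((h.lookup_tr _ _ _).1 hx).2
  · rintro ⟨q, l⟩ - ⟨q', l'⟩ - hq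
    obtain rfl : q = q' := List.append_inj_left' hq rfl
    simpa using hq

end IsPrefixTree

end Transducer

theorem DBRPNI.start_valid {A B O : Type*} [DecidableEq A] [DecidableEq B] [DecidableEq O]
    (S : List (Sample A B O)) :
    (start S).Valid (Transducer.ptt S).states.card
      ((Transducer.ptt S).states.card * max 1 (Transducer.ptt S).maxOut) := by
  have h := Transducer.isPrefixTree_ptt S
  refine ⟨List.nodup_singleton _, h.partialFold, le_rfl, h.trSum_le, ?_⟩
  rw [Transducer.outSum, ← smul_eq_mul]
  refine (Finset.sum_le_card_nsmul _ _ _ fun q hq => ?_).trans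
    (Nat.mul_le_mul_right _ (Finset.card_le_card Finset.sdiff_subset))
  exact (Finset.le_sup (f := (Transducer.ptt S).outSize)
    (Finset.sdiff_subset hq)).trans (le_max_right _ _)

open Transducer

/-! ### Structure complete samples -/

theorem DBMM.run_append {V A B O : Type*} (N : DBMM V A B O) (w : List B) (l : B) :
    N.run (w ++ [l]) = N.trans (N.run w) l := by
  simp [DBMM.run]

namespace StructureComplete

variable {V A B O : Type*} [DecidableEq A] [DecidableEq B] [DecidableEq O]
  {N : DBMM V A B O} {S : List (Sample A B O)}

theorem mem_states_ptt (hS : StructureComplete N S) {x : List B} :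
    x ∈ (ptt S).states ↔ ∃ s ∈ S, ∃ i, Sample.betaWord (s.take i) = x := by
  rw [Transducer.mem_states_ptt, or_iff_right_of_imp]
  rintro rfl
  obtain ⟨s, hs, -⟩ := hS.stateCoverage N.init
  exact ⟨s, hs, 0, by simp [Sample.betaWord]⟩

/-- Nodes of the prefix tree that belong to different target states have different outputs at some
common input. -/
theorem conflict (hS : StructureComplete N S) {x y : List B} (hx : x ∈ (ptt S).states)
    (hy : y ∈ (ptt S).states) (h : N.run x ≠ N.run y) :
    ∃ a o₁ o₂, (x, a, o₁) ∈ observed S ∧ (y, a, o₂) ∈ observed S ∧ o₁ ≠ o₂ := by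
  obtain ⟨s, hs, i, rfl⟩ := hS.mem_states_ptt.1 hx
  obtain ⟨t, ht, j, rfl⟩ := hS.mem_states_ptt.1 hy
  exact hS.conflictConvergence s hs t ht i j h

theorem exists_run_eq (hS : StructureComplete N S) (v : V) :
    ∃ x ∈ (ptt S).states, N.run x = v := by
  obtain ⟨s, hs, i, h⟩ := hS.stateCoverage v
  exact ⟨_, hS.mem_states_ptt.2 ⟨s, hs, i, rfl⟩, h⟩

theorem exists_edge (hS : StructureComplete N S) (v : V) (l : B) :
    ∃ x ∈ (ptt S).states, N.run x = v ∧ x ++ [l] ∈ (ptt S).states := by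
  obtain ⟨s, hs, i, o, hi, h⟩ := hS.transitionCoverage v _ l rfl
  refine ⟨_, hS.mem_states_ptt.2 ⟨s, hs, i, rfl⟩, h, hS.mem_states_ptt.2 ⟨s, hs, i + 1, ?_⟩⟩
  rw [List.take_add_one, hi]
  simp [Sample.betaWord]

end StructureComplete

theorem mem_states_ptt_of_observed {A B O : Type*} [DecidableEq A] [DecidableEq B] [DecidableEq O]
    {S : List (Sample A B O)} {x : List B} {a : A} {o : O} (h : (x, a, o) ∈ observed S) :
    x ∈ (ptt S).states := by
  obtain ⟨s, hs, i, -, hi⟩ := h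
  exact mem_states_ptt.2 (Or.inr ⟨s, hs, i, hi⟩)

theorem DBMM.Resolvent.lookup_ptt {V A B O : Type*} [DecidableEq A] [DecidableEq B] [DecidableEq O]
    {N : DBMM V A B O} {S : List (Sample A B O)} (hN : N.Resolvent (observed S)) {x : List B}
    {a : A} {o : O} (h : (x, a, o) ∈ observed S) : ((ptt S).out x).lookup a = some o := by
  obtain ⟨o', ho'⟩ := exists_lookup_ptt h
  rw [ho', ← hN _ _ _ h, hN _ _ _ (observed_of_lookup_ptt ho')]

/-! ### Merging under structure complete samples -/

/-- The transducer arises from the prefix tree by identifying states that lead to the same state of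
the target `N`.  States are named by words, so `N.run` is the map to the states of the target. -/
structure Labelled {V A B O : Type*} [DecidableEq A] [DecidableEq B] (N : DBMM V A B O)
    (S : List (Sample A B O)) (M : Transducer (List B) A B O) : Prop where
  init_eq : M.init = []
  hom : ∀ p l q, M.Edge p l q → N.run q = N.trans (N.run p) l
  states_sub : M.states ⊆ (ptt S).states
  out_ptt : ∀ q a o, ((ptt S).out q).lookup a = some o → (M.out q).lookup a = some o
  out_observed : ∀ q ∈ M.states, ∀ a o, (M.out q).lookup a = some o →
    ∃ w, (w, a, o) ∈ observed S ∧ N.run w = N.run q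
  exists_state : ∀ v, ∃ q ∈ M.states, N.run q = v
  exists_tr : ∀ v l, ∃ q ∈ M.states, N.run q = v ∧ ∃ x, (M.tr q).lookup l = some x
  exists_out : ∀ w a o, (w, a, o) ∈ observed S →
    ∃ q ∈ M.states, N.run q = N.run w ∧ (M.out q).lookup a = some o

namespace Labelled

variable {V A B O : Type*} [DecidableEq A] [DecidableEq B] [DecidableEq O]
  {N : DBMM V A B O} {S : List (Sample A B O)} {M : Transducer (List B) A B O}
  {p r b : List B} {red : List (List B)} {ws : List (List B × List B)} {l : B}

theorem ptt (hN : N.Resolvent (observed S)) (hS : StructureComplete N S) :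
    Labelled N S (ptt S) := by
  have h := isPrefixTree_ptt S
  refine ⟨h.init_eq, ?_, Finset.Subset.refl _, fun _ _ _ ho => ho, ?_, hS.exists_run_eq, ?_, ?_⟩
  · rintro p l q ⟨-, hq⟩
    rw [((h.lookup_tr _ _ _).1 hq).1, DBMM.run_append]
  · exact fun q _ a o ho => ⟨q, observed_of_lookup_ptt ho, rfl⟩
  · intro v l
    obtain ⟨x, hx, hv, hl⟩ := hS.exists_edge v l
    exact ⟨x, hx, hv, _, (h.lookup_tr _ _ _).2 ⟨rfl, hl⟩⟩
  · exact fun w a o ho => ⟨w, mem_states_ptt_of_observed ho, rfl, hN.lookup_ptt ho⟩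

theorem out_eq (hN : N.Resolvent (observed S)) (h : Labelled N S M) {q : List B}
    (hq : q ∈ M.states) {a : A} {o : O} (ho : (M.out q).lookup a = some o) :
    N.out (N.run q) a = some o := by
  obtain ⟨w, hw, hq⟩ := h.out_observed q hq a o ho
  rw [← hq]
  exact hN _ _ _ hw

/-- States of the same target state are compatible. -/
theorem compatible (hN : N.Resolvent (observed S)) (h : Labelled N S M) (hr : r ∈ M.states)
    (hb : b ∈ M.states) (hrb : N.run r = N.run b) : M.Compatible r b := by
  rintro ⟨a, o'⟩ he o ho
  have h₁ := h.out_eq hN hr ho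
  have h₂ := h.out_eq hN hb (AList.mem_lookup_iff.2 he)
  rw [hrb, h₂] at h₁
  exact (Option.some.inj h₁).symm

/-- States of different target states are told apart by the outputs recorded at their names. -/
theorem not_compatible (hN : N.Resolvent (observed S)) (hS : StructureComplete N S)
    (h : Labelled N S M) (hr : r ∈ M.states) (hb : b ∈ M.states) (hrb : N.run r ≠ N.run b) :
    ¬ M.Compatible r b := by
  obtain ⟨a, o₁, o₂, h₁, h₂, hne⟩ := hS.conflict (h.states_sub hr) (h.states_sub hb) hrb
  intro hc
  exact hne (hc ⟨a, o₂⟩ (AList.mem_lookup_iff.1 (h.out_ptt _ _ _ (hN.lookup_ptt h₂))) o₁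
    (h.out_ptt _ _ _ (hN.lookup_ptt h₁)))

theorem redirect (h : Labelled N S M) (hp : p ∈ M.states) (hb : (M.tr p).lookup l = some b)
    (hrb : N.run r = N.run b) : Labelled N S (M.redirect p l r) := by
  refine ⟨h.init_eq, ?_, h.states_sub, h.out_ptt, h.out_observed, h.exists_state, ?_,
    h.exists_out⟩
  · intro x m y e
    rcases edge_redirect.1 e with ⟨rfl, rfl, rfl, -⟩ | e
    · rw [hrb, h.hom _ _ _ ⟨hp, hb⟩]
    · exact h.hom _ _ _ e.2
  · intro v m
    obtain ⟨q, hq, hv, x, hx⟩ := h.exists_tr v m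
    by_cases hqp : q = p ∧ m = l
    · obtain ⟨rfl, rfl⟩ := hqp
      exact ⟨q, hq, hv, r, (edge_redirect.2 (Or.inl ⟨rfl, rfl, rfl, hp⟩)).2⟩
    · exact ⟨q, hq, hv, x, (edge_redirect.2
        (Or.inr ⟨fun h₁ h₂ => hqp ⟨h₁, h₂⟩, hq, hx⟩)).2⟩

theorem absorb (hN : N.Resolvent (observed S)) (h : Labelled N S M) (hr : r ∈ M.states)
    (hb : b ∈ M.states) (hne : r ≠ b) (hrb : N.run r = N.run b) :
    Labelled N S (M.absorb r b) := by
  have hmem : ∀ {q}, q ∈ M.states → q ≠ b → q ∈ (M.absorb r b).states := fun hq hqb =>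
    Finset.mem_erase.2 ⟨hqb, hq⟩
  have hr' := hmem hr hne
  refine ⟨h.init_eq, ?_, (Finset.erase_subset _ _).trans h.states_sub,
    fun q a o ho => lookup_out_absorb (h.out_ptt q a o ho), ?_, ?_, ?_, ?_⟩
  · intro p l q e
    obtain ⟨-, e | ⟨rfl, -, e⟩⟩ := (edge_absorb hr hne).1 e
    · exact h.hom _ _ _ e
    · rw [hrb]
      exact h.hom _ _ _ ⟨hb, e⟩
  · intro q hq' a o ho
    have hq : q ∈ M.states := Finset.mem_of_mem_erase hq'
    by_cases hqr : q = r
    · subst hqr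
      rcases lookup_out_absorb_self.1 ho with ho | ⟨-, ho⟩
      · exact h.out_observed q hq a o ho
      · rw [hrb]
        exact h.out_observed b hb a o ho
    · rw [out_absorb_of_ne hqr] at ho
      exact h.out_observed q hq a o ho
  · intro v
    obtain ⟨q, hq, hv⟩ := h.exists_state v
    by_cases hqb : q = b
    · exact ⟨r, hr', by rw [hrb, ← hqb, hv]⟩
    · exact ⟨q, hmem hq hqb, hv⟩
  · intro v l
    obtain ⟨q, hq, hv, x, hx⟩ := h.exists_tr v l
    by_cases hqb : q = b
    · subst hqb
      refine ⟨r, hr', by rw [hrb, hv], ?_⟩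
      cases hy : (M.tr r).lookup l with
      | none => exact ⟨x, lookup_tr_absorb_self.2 (Or.inr ⟨hy, hx⟩)⟩
      | some y => exact ⟨y, lookup_tr_absorb_self.2 (Or.inl hy)⟩
    · exact ⟨q, hmem hq hqb, hv, x, lookup_tr_absorb hx⟩
  · intro w a o ho
    obtain ⟨q, hq, hw, hx⟩ := h.exists_out w a o ho
    by_cases hqb : q = b
    · subst hqb
      refine ⟨r, hr', by rw [hrb, hw], ?_⟩
      cases hy : (M.out r).lookup a with
      | none => exact lookup_out_absorb_self.2 (Or.inr ⟨hy, hx⟩)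
      | some o' =>
        have h₁ := h.out_eq hN hr hy
        rw [hrb, h.out_eq hN hq hx] at h₁
        exact lookup_out_absorb_self.2 (Or.inl (by rw [hy, h₁]))
    · exact ⟨q, hmem hq hqb, hw, lookup_out_absorb hx⟩

/-- Merging two states of the same target state never fails: the implied merges are of this kind
again, and no folded pair is incompatible. -/
theorem exists_fold (hN : N.Resolvent (observed S)) (hf : PartialFold M red ws)
    (h : Labelled N S M) (hws : ∀ w ∈ ws, N.run w.1 = N.run w.2) :
    ∃ M', (M.fold ws).1 = some M' ∧ Labelled N S M' := by
  have hmem : ∀ {M : Transducer (List B) A B O} {r b ws}, PartialFold M red ((r, b) :: ws) →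
      r ∈ M.states ∧ b ∈ M.states := fun hf =>
    ⟨hf.mem_of_reach (hf.target _ List.mem_cons_self), (hf.pending _ List.mem_cons_self).1⟩
  refine PartialFold.fold_induction (P := fun M ws => Labelled N S M →
    (∀ w ∈ ws, N.run w.1 = N.run w.2) → ∃ M', (M.fold ws).1 = some M' ∧ Labelled N S M')
    ?_ ?_ ?_ hf h hws
  · intro M _ h _
    exact ⟨M, by rw [fold], h⟩
  · intro M r b ws hf hc ih h hws
    have hrb := hws _ List.mem_cons_self
    obtain ⟨hr, hb⟩ := hmem hf
    rw [hf.fold_cons, if_pos hc]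
    refine ih (h.absorb hN hr hb hf.ne hrb) fun w hw => ?_
    rcases List.mem_append.1 hw with hw | hw
    · obtain ⟨d, e⟩ := w
      obtain ⟨m, hd, he⟩ := mem_implied.1 hw
      rw [h.hom _ _ _ ⟨hr, hd⟩, h.hom _ _ _ ⟨hb, he⟩, hrb]
    · exact hws w (List.mem_cons_of_mem _ hw)
  · intro M r b ws hf hc h hws
    obtain ⟨hr, hb⟩ := hmem hf
    exact absurd (h.compatible hN hr hb (hws _ List.mem_cons_self)) hc

end Labelled

namespace DBRPNI

variable {V A B O : Type*} [DecidableEq A] [DecidableEq B] [DecidableEq O]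
  {N : DBMM V A B O} {S : List (Sample A B O)} {c d : Config (List B) A B O} {T K t : ℕ}

/-- In the invariant for structure complete samples, different red states belong to different
states of the target. -/
structure Config.Correct (N : DBMM V A B O) (S : List (Sample A B O))
    (c : Config (List B) A B O) : Prop where
  labelled : Labelled N S c.mach
  inj : ∀ r ∈ c.red, ∀ r' ∈ c.red, N.run r = N.run r' → r = r'

namespace Config.Correct

/-- A blue state is merged with the red state of the same target state, all other attempts fail at
the first pair. -/
theorem tryRed (hN : N.Resolvent (observed S)) (hS : StructureComplete N S) (hc : c.Correct N S)
    (hv : c.Valid T K) {p b : List B} {l : B} (hb : c.Blue p l b) {rs : List (List B)}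
    (hrs : ∀ r ∈ rs, r ∈ c.red) :
    ((c.mach.tryRed p l b rs).2 ≤
      1 + rs.length * (3 + 2 * c.mach.outSize b) + 3 * (2 + 3 * T + 2 * K)) ∧
    (∀ M', (c.mach.tryRed p l b rs).1 = some M' → Labelled N S M') ∧
    ((c.mach.tryRed p l b rs).1 = none → ∀ r ∈ rs, N.run r ≠ N.run b) := by
  induction rs with
  | nil => simp [Transducer.tryRed]
  | cons r rs ih =>
    have hr := hrs r List.mem_cons_self
    obtain ⟨ih₁, ih₂, ih₃⟩ := ih fun x hx => hrs x (List.mem_cons_of_mem _ hx)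
    have hf := hv.partialFold
    have hps := hf.red_sub _ hb.1
    have hbs := hf.closed _ _ _ ⟨hps, hb.2.1⟩
    rw [Transducer.tryRed, List.length_cons, Nat.succ_mul]
    by_cases hrb : N.run r = N.run b
    · obtain ⟨M', hM, hM'⟩ := (hc.labelled.redirect hps hb.2.1 hrb).exists_fold hN
        (hf.redirect hb.1 hb.2.1 hb.2.2 hr) (by simpa using hrb)
      have ht := hv.merge_time_le hb hr
      change (c.mach.merge p l b r).1 = _ at hM
      rcases hm : c.mach.merge p l b r with ⟨o, t⟩
      rw [hm] at hM ht
      dsimp only at hM ht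
      subst hM
      refine ⟨?_, ?_, by simp⟩
      · dsimp only
        omega
      · rintro M'' hM''
        cases hM''
        exact hM'
    · rw [merge_of_not_compatible hf hb.1 hb.2.1 hb.2.2 hr
        (hc.labelled.not_compatible hN hS (hf.red_sub _ hr) hbs hrb)]
      refine ⟨?_, ih₂, fun hn x hx => ?_⟩
      · dsimp only
        omega
      · rcases List.mem_cons.1 hx with rfl | hx
        · exact hrb
        · exact ih₃ hn x hx

theorem step (hN : N.Resolvent (observed S)) (hS : StructureComplete N S) (hc : c.Correct N S)
    (hv : c.Valid T K) (hs : Step c t d) : d.Correct N S := by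
  cases hs with
  | merge hb hrs ht =>
    exact ⟨(hc.tryRed hN hS hv hb fun r hr => hrs.mem_iff.1 hr).2.1 _ (by rw [ht]), hc.inj⟩
  | promote hb hrs ht =>
    have hne := (hc.tryRed hN hS hv hb fun r hr => hrs.mem_iff.1 hr).2.2 (by rw [ht])
    refine ⟨hc.labelled, fun r hr r' hr' hrr => ?_⟩
    rcases List.mem_cons.1 hr with hrb | hr₁ <;> rcases List.mem_cons.1 hr' with hrb' | hr₁'
    · exact hrb.trans hrb'.symm
    · exact absurd (hrb ▸ hrr.symm) (hne _ (hrs.mem_iff.2 hr₁'))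
    · exact absurd (hrb' ▸ hrr) (hne _ (hrs.mem_iff.2 hr₁))
    · exact hc.inj r hr₁ r' hr₁' hrr

theorem start (hN : N.Resolvent (observed S)) (hS : StructureComplete N S) :
    (start S).Correct N S := by
  refine ⟨.ptt hN hS, fun r hr r' hr' _ => ?_⟩
  rw [List.mem_singleton.1 hr, List.mem_singleton.1 hr']

theorem run (hN : N.Resolvent (observed S)) (hS : StructureComplete N S) (hc : c.Correct N S)
    (hv : c.Valid T K) (hr : Run c t d) : d.Correct N S := by
  induction hr with
  | refl => exact hc
  | tail hr hs ih => exact ih.step hN hS (hv.run hr) hs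

theorem red_length_le [Fintype V] (hc : c.Correct N S) (hv : c.Valid T K) :
    c.red.length ≤ Fintype.card V := by
  rw [← List.toFinset_card_of_nodup hv.nodup]
  exact Finset.card_le_card_of_injOn N.run (fun _ _ => Finset.mem_univ _) fun r hr r' hr' =>
    hc.inj r (List.mem_toFinset.1 hr) r' (List.mem_toFinset.1 hr')

end Config.Correct

/-! ### Running time under structure complete samples -/

open Classical in
/-- The pairs `(p, l)` for which the transition of the red state `p` under `l` leads to a red
state.  Every round adds one, and none is lost. -/
noncomputable def Config.settled [Fintype B] (c : Config (List B) A B O) : Finset (List B × B) :=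
  {x ∈ c.red.toFinset ×ˢ Finset.univ | ∃ q ∈ c.red, (c.mach.tr x.1).lookup x.2 = some q}

theorem Config.mem_settled [Fintype B] {p : List B} {l : B} :
    (p, l) ∈ c.settled ↔ p ∈ c.red ∧ ∃ q ∈ c.red, (c.mach.tr p).lookup l = some q := by
  simp [Config.settled]

theorem Config.Correct.card_settled_le [Fintype V] [Fintype B] (hc : c.Correct N S)
    (hv : c.Valid T K) : c.settled.card ≤ Fintype.card V * Fintype.card B := by
  refine (Finset.card_filter_le _ _).trans ?_
  rw [Finset.card_product, List.toFinset_card_of_nodup hv.nodup, Finset.card_univ]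
  exact Nat.mul_le_mul_right _ (hc.red_length_le hv)

theorem Config.Valid.card_settled_lt [Fintype B] (hv : c.Valid T K) (hs : Step c t d) :
    c.settled.card < d.settled.card := by
  have key : ∀ {p l b}, c.Blue p l b → (p, l) ∈ d.settled →
      (∀ q m, (q, m) ≠ (p, l) → (q, m) ∈ c.settled → (q, m) ∈ d.settled) →
      c.settled.card < d.settled.card := fun {p l b} hb hpl hsub => by
    have hnot : (p, l) ∉ c.settled := fun h => by
      obtain ⟨-, q, hq, hx⟩ := Config.mem_settled.1 h
      obtain rfl := Option.some.inj (hb.2.1.symm.trans hx)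
      exact hb.2.2 hq
    refine Finset.card_lt_card ⟨fun x hx => ?_, fun h => hnot (h hpl)⟩
    exact hsub x.1 x.2 (fun h => hnot (h ▸ hx)) hx
  cases hs with
  | @merge p l b _ _ _ hb hrs ht =>
    have hm := hv.merged hb hrs ht
    refine key hb (Config.mem_settled.2 ⟨hb.1, hm.tr_red⟩) fun q m hne hq => ?_
    obtain ⟨hq, x, hx, hqx⟩ := Config.mem_settled.1 hq
    exact Config.mem_settled.2 ⟨hq, x, hx, hm.tr_mono q m x hqx hne⟩
  | @promote p l b _ _ hb hrs ht =>
    refine key hb (Config.mem_settled.2 ⟨List.mem_cons_of_mem _ hb.1, b, List.mem_cons_self,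
      hb.2.1⟩) fun q m hne hq => ?_
    obtain ⟨hq, x, hx, hqx⟩ := Config.mem_settled.1 hq
    exact Config.mem_settled.2 ⟨List.mem_cons_of_mem _ hq, x, List.mem_cons_of_mem _ hx, hqx⟩

/-- The outputs of states that are not red pay for the failing attempts of a round, since those of
the selected blue state are absorbed by red states or become red themselves. -/
theorem Config.Correct.step_time_le [Fintype V] (hN : N.Resolvent (observed S))
    (hS : StructureComplete N S) (hc : c.Correct N S) (hv : c.Valid T K) (hs : Step c t d) :
    t + 2 * Fintype.card V * d.mach.outSum d.red.toFinset ≤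
      (2 + 5 * T + 3 * (2 + 3 * T + 2 * K)) +
        2 * Fintype.card V * c.mach.outSum c.red.toFinset := by
  have hbt := hv.blueTime_le
  have key : ∀ {p l b rs} {P : ℕ}, c.Blue p l b → rs.Perm c.red →
      P + c.mach.outSize b ≤ c.mach.outSum c.red.toFinset →
      c.blueTime + (c.mach.tryRed p l b rs).2 + 2 * Fintype.card V * P ≤
        (2 + 5 * T + 3 * (2 + 3 * T + 2 * K)) +
          2 * Fintype.card V * c.mach.outSum c.red.toFinset := fun {p l b rs P} hb hrs hP => by
    have h₁ := (hc.tryRed hN hS hv hb fun r hr => hrs.mem_iff.1 hr).1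
    have h₂ : rs.length * (2 * c.mach.outSize b)
        ≤ Fintype.card V * (2 * c.mach.outSize b) :=
      Nat.mul_le_mul_right _ (hrs.length_eq.trans_le (hc.red_length_le hv))
    have h₃ := hrs.length_eq.trans_le hv.red_length_le
    have h₄ := Nat.mul_le_mul_left (2 * Fintype.card V) hP
    nlinarith
  cases hs with
  | merge hb hrs ht =>
    have := key hb hrs (hv.merged hb hrs ht).outSum_red_le
    rwa [ht] at this
  | @promote p l b _ _ hb hrs ht =>
    have hbs : b ∈ c.mach.states \ c.red.toFinset := by
      simpa [hb.2.2] using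
        hv.partialFold.closed _ _ _ ⟨hv.partialFold.red_sub _ hb.1, hb.2.1⟩
    have := key hb hrs (P := c.mach.outSum (b :: c.red).toFinset) (le_of_eq ?_)
    · rwa [ht] at this
    · rw [outSum, outSum, List.toFinset_cons, Finset.sdiff_insert, Finset.sum_erase_add _ _ hbs]

theorem Config.Correct.run_time_le [Fintype V] [Fintype B] (hN : N.Resolvent (observed S))
    (hS : StructureComplete N S) (hc : c.Correct N S) (hv : c.Valid T K) (hr : Run c t d) :
    t + 2 * Fintype.card V * d.mach.outSum d.red.toFinset ≤
      d.settled.card * (2 + 5 * T + 3 * (2 + 3 * T + 2 * K)) +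
        2 * Fintype.card V * c.mach.outSum c.red.toFinset := by
  induction hr with
  | refl => simp
  | @tail d e s t hr hs ih =>
    have h₁ := (hc.run hN hS hv hr).step_time_le hN hS (hv.run hr) hs
    have h₂ := Nat.mul_le_mul_right (2 + 5 * T + 3 * (2 + 3 * T + 2 * K))
      ((hv.run hr).card_settled_lt hs)
    rw [Nat.succ_mul] at h₂
    omega

theorem Config.Correct.time_le [Fintype V] [Fintype B] {F : ℕ} {M : Transducer (List B) A B O}
    (hN : N.Resolvent (observed S)) (hS : StructureComplete N S) (hc : c.Correct N S)
    (hv : c.Valid T (T * F)) (hT : 0 < T) (hF : 0 < F) (hr : ReturnsFrom c M t) :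
    t ≤ 60 * (Fintype.card V * max 1 (Fintype.card B) * T * F) := by
  obtain ⟨d, s, hr, -, -, rfl⟩ := hr
  have h₁ := hc.run_time_le hN hS hv hr
  have h₂ := (hv.run hr).blueTime_le
  have h₃ : c.mach.outSum c.red.toFinset ≤ T * F :=
    (Finset.sum_le_sum_of_subset (Finset.sdiff_subset_sdiff le_rfl (Finset.empty_subset _))).trans
      hv.outSum_le
  have h₄ : d.settled.card ≤ Fintype.card V * max 1 (Fintype.card B) :=
    ((hc.run hN hS hv hr).card_settled_le (hv.run hr)).trans
      (Nat.mul_le_mul_left _ (le_max_right _ _))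
  have h₅ : Fintype.card V ≤ Fintype.card V * max 1 (Fintype.card B) :=
    Nat.le_mul_of_pos_right _ (by simp)
  have h₆ : 0 < Fintype.card V := Fintype.card_pos_iff.2 ⟨N.init⟩
  generalize Fintype.card V * max 1 (Fintype.card B) = W at *
  have h₇ : T ≤ T * F := Nat.le_mul_of_pos_right _ hF
  have h₈ : d.settled.card * (2 + 5 * T + 3 * (2 + 3 * T + 2 * (T * F))) ≤ W * (28 * (T * F)) :=
    Nat.mul_le_mul h₄ (by omega)
  have h₉ : 2 * Fintype.card V * c.mach.outSum c.red.toFinset ≤ 2 * W * (T * F) :=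
    Nat.mul_le_mul (by omega) h₃
  have h₁₀ : 1 * (T * F) ≤ W * (T * F) := Nat.mul_le_mul_right _ (by omega)
  -- `W * (T * F)` dominates all three parts: settled pairs, failing attempts and the last scan
  rw [mul_assoc W]
  nlinarith

end DBRPNI

/-! ### The returned machine -/

section Target

variable {V W A B O : Type*} [DecidableEq A] [DecidableEq B] [DecidableEq O]
  {N : DBMM V A B O} {S : List (Sample A B O)}

/-- Without blue states left, the states correspond to those of the target. -/
theorem Labelled.exists_is {M : Transducer (List B) A B O}
    (h : Labelled N S M)
    (hclosed : ∀ p l q, M.Edge p l q → q ∈ M.states)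
    (hinj : ∀ q ∈ M.states, ∀ q' ∈ M.states, N.run q = N.run q' → q = q')
    (hinit : M.init ∈ M.states) :
    ∃ D : DBMM {q // q ∈ M.states} A B O, M.Is D ∧
      ∃ φ : V ≃ {q // q ∈ M.states}, φ N.init = D.init ∧
        (∀ q l, φ (N.trans q l) = D.trans (φ q) l) ∧
        (∀ q a o, D.out (φ q) a = some o ↔ ∃ w, (w, a, o) ∈ observed S ∧ N.run w = q) := by
  have htr : ∀ (q : {q // q ∈ M.states}) (l : B), ∃ x : {q // q ∈ M.states},
      (M.tr q.1).lookup l = some x.1 := by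
    rintro ⟨q, hq⟩ l
    obtain ⟨q', hq', hqq, x, hx⟩ := h.exists_tr (N.run q) l
    obtain rfl := hinj q' hq' q hq hqq
    exact ⟨⟨x, hclosed _ _ _ ⟨hq, hx⟩⟩, hx⟩
  choose tr htr using htr
  have hbij : Function.Bijective fun q : {q // q ∈ M.states} => N.run q.1 := by
    refine ⟨fun q q' hqq => Subtype.ext (hinj _ q.2 _ q'.2 hqq), fun v => ?_⟩
    obtain ⟨q, hq, hv⟩ := h.exists_state v
    exact ⟨⟨q, hq⟩, hv⟩
  let φ : V ≃ {q // q ∈ M.states} := (Equiv.ofBijective _ hbij).symm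
  have hφ : ∀ q, N.run (φ q).1 = q := fun q => (Equiv.ofBijective _ hbij).apply_symm_apply q
  have hφ' : ∀ {q : {q // q ∈ M.states}} {v}, N.run q.1 = v → φ v = q := fun {q v} hq =>
    hbij.1 ((hφ v).trans hq.symm)
  refine ⟨⟨⟨M.init, hinit⟩, tr, fun q a => (M.out q.1).lookup a⟩,
    ⟨rfl, htr, fun _ _ => rfl⟩, φ, hφ' ?_, fun q l => hφ' ?_, fun q a o => ⟨fun ho => ?_, ?_⟩⟩
  · change N.run M.init = _
    rw [h.init_eq]
    rfl
  · rw [h.hom _ _ _ ⟨(φ q).2, htr (φ q) l⟩, hφ]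
  · obtain ⟨w, hw, hq⟩ := h.out_observed _ (φ q).2 a o ho
    exact ⟨w, hw, hq.trans (hφ q)⟩
  · rintro ⟨w, hw, rfl⟩
    obtain ⟨q, hq, hqw, ho⟩ := h.exists_out w a o hw
    have : φ (N.run w) = ⟨q, hq⟩ := hφ' hqw
    rw [this]
    exact ho

/-- In a machine that reproduces structure complete samples, prefixes that the target tells apart
lead to different states. -/
theorem StructureComplete.run_eq_of_run_eq (hS : StructureComplete N S) {E : DBMM W A B O}
    (hE : E.Resolvent (observed S)) {x y : List B} (hx : x ∈ (ptt S).states)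
    (hy : y ∈ (ptt S).states) (h : E.run x = E.run y) : N.run x = N.run y := by
  by_contra hne
  obtain ⟨a, o₁, o₂, h₁, h₂, ho⟩ := hS.conflict hx hy hne
  have h₁ := hE _ _ _ h₁
  rw [h, hE _ _ _ h₂] at h₁
  exact ho (Option.some.inj h₁).symm

theorem StructureComplete.card_le [Fintype V] [Fintype W] (hS : StructureComplete N S)
    {E : DBMM W A B O} (hE : E.Resolvent (observed S)) : Fintype.card V ≤ Fintype.card W := by
  choose u hu hu' using hS.exists_run_eq
  refine Fintype.card_le_of_injective (fun v => E.run (u v)) fun v v' h => ?_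
  rw [← hu' v, ← hu' v']
  exact hS.run_eq_of_run_eq hE (hu v) (hu v') h

/-- A machine of the size of the target that reproduces structure complete samples has the states
and the transitions of the target. -/
theorem StructureComplete.exists_equiv [Fintype V] [Fintype W] (hS : StructureComplete N S)
    {E : DBMM W A B O} (hE : E.Resolvent (observed S)) (hcard : Fintype.card V = Fintype.card W) :
    ∃ f : V ≃ W, f N.init = E.init ∧ (∀ q l, f (N.trans q l) = E.trans (f q) l) ∧
      ∀ x ∈ (ptt S).states, f (N.run x) = E.run x := by
  choose u hu hu' using hS.exists_run_eq
  have hinj : Function.Injective fun v => E.run (u v) := fun v v' h => by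
    rw [← hu' v, ← hu' v']
    exact hS.run_eq_of_run_eq hE (hu v) (hu v') h
  have hbij := (Fintype.bijective_iff_injective_and_card _).2 ⟨hinj, hcard⟩
  let f : V ≃ W := Equiv.ofBijective _ hbij
  have hf : ∀ x ∈ (ptt S).states, f (N.run x) = E.run x := fun x hx => by
    obtain ⟨v, hv⟩ := hbij.2 (E.run x)
    have : N.run x = v := by
      rw [← hu' v]
      exact hS.run_eq_of_run_eq hE hx (hu v) hv.symm
    rw [this]
    exact hv
  refine ⟨f, hf [] (isPrefixTree_ptt S).nil_mem, fun q l => ?_, hf⟩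
  obtain ⟨x, hx, rfl, hl⟩ := hS.exists_edge q l
  rw [← DBMM.run_append, hf _ hl, hf _ hx, DBMM.run_append]

variable {D : DBMM W A B O} (φ : V ≃ W) (hinit : φ N.init = D.init)
  (htrans : ∀ q l, φ (N.trans q l) = D.trans (φ q) l)
  (hout : ∀ q a o, D.out (φ q) a = some o ↔ ∃ w, (w, a, o) ∈ observed S ∧ N.run w = q)

include hinit htrans

theorem DBMM.run_equiv (w : List B) : D.run w = φ (N.run w) := by
  induction w using List.reverseRecOn with
  | nil => exact hinit.symm
  | append_singleton w l ih => rw [DBMM.run_append, DBMM.run_append, ih, htrans]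

include hout

/-- The target with the recorded outputs predicts exactly the behaviors that are recorded at some
prefix of the same target state. -/
theorem DBMM.resolvent_iff_observed (R : Set (List B × A × O)) :
    D.Resolvent R ↔
      ∀ w a o, (w, a, o) ∈ R → ∃ u, (u, a, o) ∈ observed S ∧ N.run u = N.run w := by
  refine forall_congr' fun w => forall_congr' fun a => forall_congr' fun o =>
    imp_congr_right fun _ => ?_
  rw [DBMM.run_equiv φ hinit htrans, hout]

/-- Resolvence is the only issue, as every machine that reproduces the samples has at least as many
states as the target. -/
theorem StructureComplete.minimalResolvent_iff [Fintype V] [Fintype W]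
    (hS : StructureComplete N S) {R : Set (List B × A × O)} (hR : observed S ⊆ R) :
    D.MinimalResolvent R ↔
      ∀ w a o, (w, a, o) ∈ R → ∃ u, (u, a, o) ∈ observed S ∧ N.run u = N.run w := by
  rw [← DBMM.resolvent_iff_observed φ hinit htrans hout R]
  refine ⟨fun h => h.1, fun h => ⟨h, fun n E hE => ?_⟩⟩
  have := hS.card_le (E := E) fun w a o hw => hE w a o (hR hw)
  rwa [Fintype.card_fin, Fintype.card_congr φ] at this

theorem StructureComplete.exists_equiv_of_resolvent [Fintype V] (hS : StructureComplete N S)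
    (E : DBMM (Fin (Fintype.card V)) A B O) (hE : E.Resolvent (observed S)) :
    ∃ ψ : W ≃ Fin (Fintype.card V), ψ D.init = E.init ∧
      (∀ q l, ψ (D.trans q l) = E.trans (ψ q) l) ∧
      (∀ q a o, D.out q a = some o → E.out (ψ q) a = some o) := by
  obtain ⟨f, hf₁, hf₂, hf₃⟩ := hS.exists_equiv hE (Fintype.card_fin _).symm
  refine ⟨φ.symm.trans f, ?_, ?_, ?_⟩
  · simp [← hinit, hf₁]
  · intro q l
    obtain ⟨v, rfl⟩ := φ.surjective q
    simp [← htrans, hf₂]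
  · intro q a o ho
    obtain ⟨v, rfl⟩ := φ.surjective q
    obtain ⟨w, hw, rfl⟩ := (hout _ _ _).1 ho
    simpa [hf₃ w (mem_states_ptt_of_observed hw)] using hE _ _ _ hw

end Target

theorem mainTheorem1 :
    ∃ C : ℕ, ∀ (A B O : Type*) [DecidableEq A] [DecidableEq B] [DecidableEq O] [Fintype B]
      (S : List (Sample A B O)),
      -- every execution can be continued until it stops
      (∀ (t : ℕ) (c : DBRPNI.Config (List B) A B O), DBRPNI.Run (DBRPNI.start S) t c →
        ∃ (M : Transducer (List B) A B O) (t' : ℕ), DBRPNI.ReturnsFrom c M t') ∧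
      -- running time in the general case
      (∀ (M : Transducer (List B) A B O) (t : ℕ), DBRPNI.Returns S M t →
        t ≤ C * ((Transducer.ptt S).states.card ^ 3 * max 1 (Transducer.ptt S).maxOut)) ∧
      -- structure complete samples of an environment with feasible behaviors `R`
      (∀ (V : Type*) [Fintype V] (N : DBMM V A B O) (R : Set (List B × A × O)),
        N.Resolvent R → observed S ⊆ R → StructureComplete N S →
        ∀ (M : Transducer (List B) A B O) (t : ℕ), DBRPNI.Returns S M t →
          t ≤ C * (Fintype.card V * max 1 (Fintype.card B) * (Transducer.ptt S).states.card *
              max 1 (Transducer.ptt S).maxOut) ∧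
          ∃ D : DBMM {q // q ∈ M.states} A B O, M.Is D ∧
            -- the returned machine is the target with the outputs recorded in the samples
            (∃ φ : V ≃ {q // q ∈ M.states}, φ N.init = D.init ∧
              (∀ q l, φ (N.trans q l) = D.trans (φ q) l) ∧
              (∀ q a o, D.out (φ q) a = some o ↔
                ∃ w, (w, a, o) ∈ observed S ∧ N.run w = q)) ∧
            -- it is minimal among the machines that reproduce the samples, and it is the only one
            D.MinimalResolvent (observed S) ∧
            (∀ E : DBMM (Fin (Fintype.card V)) A B O, E.Resolvent (observed S) →
              ∃ ψ : {q // q ∈ M.states} ≃ Fin (Fintype.card V), ψ D.init = E.init ∧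
                (∀ q l, ψ (D.trans q l) = E.trans (ψ q) l) ∧
                (∀ q a o, D.out q a = some o → E.out (ψ q) a = some o)) ∧
            -- it is minimal resolvent for the environment iff no feasible output was left out
            (D.MinimalResolvent R ↔
              ∀ w a o, (w, a, o) ∈ R → ∃ u, (u, a, o) ∈ observed S ∧ N.run u = N.run w)) := by
  refine ⟨60, fun A B O _ _ _ _ S => ?_⟩
  have hv := DBRPNI.start_valid S
  have hT : 0 < (ptt S).states.card := Finset.card_pos.2 ⟨_, (isPrefixTree_ptt S).nil_mem⟩
  have hF : 0 < max 1 (ptt S).maxOut := by simp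
  refine ⟨fun t c hr => (hv.run hr).exists_returnsFrom, fun M t hM => hv.time_le hT hF hM, ?_⟩
  intro V _ N R hNR hSR hS M t hM
  have hN : N.Resolvent (observed S) := fun w a o h => hNR w a o (hSR h)
  have hc := DBRPNI.Config.Correct.start hN hS
  refine ⟨hc.time_le hN hS hv hT hF hM, ?_⟩
  obtain ⟨d, s, hr, hblue, rfl, -⟩ := hM
  have hd := hc.run hN hS hv hr
  have hf := (hv.run hr).partialFold
  have hred : ∀ {x}, x ∈ d.mach.states → x ∈ d.red := fun hx => hf.mem_red (fun p l b hp hb => by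
    by_contra hbr
    exact hblue p l b ⟨hp, hb, hbr⟩) hx
  obtain ⟨D, hD, φ, h₁, h₂, h₃⟩ := hd.labelled.exists_is hf.closed
    (fun q hq q' hq' => hd.inj q (hred hq) q' (hred hq')) (hf.red_sub _ hf.init_mem)
  exact ⟨D, hD, ⟨φ, h₁, h₂, h₃⟩,
    (hS.minimalResolvent_iff φ h₁ h₂ h₃ subset_rfl).2 fun w a o h => ⟨w, h, rfl⟩,
    hS.exists_equiv_of_resolvent φ h₁ h₂ h₃, hS.minimalResolvent_iff φ h₁ h₂ h₃ hSR⟩
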